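/- **Conventions.** All norms on $\mathbb R^n$ are Euclidean and $B_n=\{x\in\mathbb R^n:\|x\|\le 1\}$. For $g\in L^1(\mathbb R^n)$ real-valued let $\hat g(\omega)=(2\pi)^{-n}\int_{\mathbb R^n} g(x)e^{-i\langle\omega,x\rangle}dx$. For a bounded set $B\subseteq\mathbb R^n$ let $\|\omega\|_B=\sup_{x\in B}|\langle\omega,x\rangle|$. A real-valued function $f$ is *$C$-Barron on $B$* if there is a real-valued $g\in L^1(\mathbb R^n)$ with $g=f$ on $B$, with $g(x)=g(0)+\int_{\mathbb R^n}(e^{i\langle\omega,x\rangle}-1)\hat g(\omega)\,d\omega$ for all $x\in B$ (convergent integrals), and with $\int_{\mathbb R^n}\|\omega\|_B|\hat g(\omega)|\,d\omega\le C$. A map $f=(f^1,\dots,f^m)$ into $\mathbb R^m$ is *componentwise $C$-Barron on $B$* if every $f^j$ is $C$-Barron on $B$; it is *$C$-Barron on $B$* if there are $c_1,\dots,c_m$ such that $f^j$ is $c_j$-Barron on $B$ for every $j$ and $(\sum_j c_j^2)^{1/2}\le C$. A *sigmoidal* function is a bounded measurable $\sigma:\mathbb R\to\mathbb R$ with $\lim_{t\to-\infty}\sigma(t)=0$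 and $\lim_{t\to\infty}\sigma(t)=1$. A *neural network* with activation $\sigma$ and $l$ hidden layers of sizes $r_1,\dots,r_l$ is a map $x\mapsto A^{(l+1)}x^{(l)}+b^{(l+1)}$ where $x^{(0)}=x$ and $x^{(i)}=\sigma(A^{(i)}x^{(i-1)}+b^{(i)})\in\mathbb R^{r_i}$ for $1\le i\le l$, with $\sigma$ applied componentwise and arbitrary real matrices $A^{(i)}$ and vectors $b^{(i)}$ of the appropriate sizes. **Theorem.** Let $\sigma$ be sigmoidal, $\varepsilon,s>0$ and $l\ge1$. For $0\le i\le l$ let $m_i\in\mathbb N$ and let $K_i\subset\mathbb R^{m_i}$ be bounded; let $D=\operatorname{diam}K_l$. For $1\le i\le l$ let $C_i\in\mathbb R$ and let $f_i:\mathbb R^{m_{i-1}}\to\mathbb R^{m_i}$ be $1$-Lipschitz with $f_i(K_{i-1})\subseteq K_i$. Let $\mu_0$ be a Borel probability measure on $\mathbb R^{m_0}$ with $\operatorname{supp}\mu_0\subseteq K_0$. 1. If each $f_i$ is $C_i$-Barron on $K_{i-1}+sB_{m_{i-1}}$, then there is a neural network $g:\mathbb R^{m_0}\to\mathbb R^{m_l}$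 with activation $\sigma$ and $l$ hidden layers, with exactly $\lceil 4C_i^2m_i/\varepsilon^2\rceil$ nodes on the $i$th hidden layer, such that $$\left(\int_{K_0}\|f_l\circ\cdots\circ f_1-g\|^2\,d\mu_0\right)^{1/2}\le l\,\varepsilon\sqrt{(2C_l\sqrt{m_l}+D)^2\,\frac{l}{3s^2}+1}.$$ 2. If each $f_i$ is only componentwise $C_i$-Barron on $K_{i-1}+sB_{m_{i-1}}$, then there is such a network $g$ satisfying the same inequality with exactly $m_i\lceil 4C_i^2m_i/\varepsilon^2\rceil$ nodes on the $i$th hidden layer. In both cases the integral on the left converges. -/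

import Mathlib

open scoped Pointwise

/-- Fourier transform with the normalization
`f̂(ω) = (2π)⁻ⁿ ∫ f(x) e^{-i⟨ω,x⟩} dx`; meaningful for `f ∈ L¹`. -/
noncomputable def fourierHat {n : ℕ} (f : EuclideanSpace ℝ (Fin n) → ℝ)
    (ω : EuclideanSpace ℝ (Fin n)) : ℂ :=
  (1 / (2 * (Real.pi : ℂ)) ^ n) *
    ∫ x, (f x : ℂ) * Complex.exp (-(Complex.I * (inner ℝ ω x : ℝ)))

/-- `‖ω‖_B = sup_{x ∈ B} |⟨ω, x⟩|` for a bounded set `B`. -/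
noncomputable def setNorm {n : ℕ} (B : Set (EuclideanSpace ℝ (Fin n)))
    (ω : EuclideanSpace ℝ (Fin n)) : ℝ :=
  sSup ((fun x => |(inner ℝ ω x : ℝ)|) '' B)

/-- The class `𝓕_B`: integrable functions `g : ℝⁿ → ℝ` with
`g(x) = g(0) + ∫ (e^{i⟨ω,x⟩} - 1) ĝ(ω) dω` (convergent integral) for every `x ∈ B`. -/
def FourierRep {n : ℕ} (B : Set (EuclideanSpace ℝ (Fin n)))
    (g : EuclideanSpace ℝ (Fin n) → ℝ) : Prop :=
  MeasureTheory.Integrable g ∧ ∀ x ∈ B,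
    MeasureTheory.Integrable
      (fun ω => (Complex.exp (Complex.I * (inner ℝ ω x : ℝ)) - 1) * fourierHat g ω) ∧
    (g x : ℂ) = (g 0 : ℂ) +
      ∫ ω, (Complex.exp (Complex.I * (inner ℝ ω x : ℝ)) - 1) * fourierHat g ω

/-- `f ∈ Γ_B(C)`: the restriction of the real-valued function `f` to `B` has an extension
`g ∈ 𝓕_B` with `∫ ‖ω‖_B |ĝ(ω)| dω ≤ C` (a convergent integral, so `0 ≤ C`). -/
def IsBarronOn {n : ℕ} (B : Set (EuclideanSpace ℝ (Fin n))) (C : ℝ)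
    (f : EuclideanSpace ℝ (Fin n) → ℝ) : Prop :=
  ∃ g : EuclideanSpace ℝ (Fin n) → ℝ, (∀ x ∈ B, g x = f x) ∧ FourierRep B g ∧
    MeasureTheory.Integrable (fun ω => setNorm B ω * ‖fourierHat g ω‖) ∧
    ∫ ω, setNorm B ω * ‖fourierHat g ω‖ ≤ C

/-- A vector-valued map is `C`-Barron on `B` when the Euclidean norm of a vector of Barron bounds
of its components is at most `C`. -/
def IsVectorBarronOn {n m : ℕ} (B : Set (EuclideanSpace ℝ (Fin n))) (C : ℝ)
    (f : EuclideanSpace ℝ (Fin n) → EuclideanSpace ℝ (Fin m)) : Prop :=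
  ∃ c : Fin m → ℝ, (∀ j, IsBarronOn B (c j) (fun x => f x j)) ∧ √(∑ j, c j ^ 2) ≤ C

/-- Every component of a vector-valued map is `C`-Barron on `B`. -/
def IsComponentwiseBarronOn {n m : ℕ} (B : Set (EuclideanSpace ℝ (Fin n))) (C : ℝ)
    (f : EuclideanSpace ℝ (Fin n) → EuclideanSpace ℝ (Fin m)) : Prop :=
  ∀ j, IsBarronOn B C (fun x => f x j)

/-- Sigmoidal functions: bounded, measurable, with limits `0` at `-∞` and `1` at `+∞`. -/
structure IsSigmoidal (σ : ℝ → ℝ) : Prop where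
  measurable : Measurable σ
  bounded : ∃ M : ℝ, ∀ t, |σ t| ≤ M
  tendsto_atBot : Filter.Tendsto σ Filter.atBot (nhds 0)
  tendsto_atTop : Filter.Tendsto σ Filter.atTop (nhds 1)

/-- Parameters of a feedforward network with input space `ℝᵖ`, output space `ℝ^q`, and one hidden
layer for each entry of the list, the entry being the number of its nodes. -/
inductive NeuralNetwork (q : ℕ) : ℕ → List ℕ → Type
  | output {p : ℕ} (A : Matrix (Fin q) (Fin p) ℝ) (b : Fin q → ℝ) : NeuralNetwork q p []
  | hidden {p h : ℕ} {hs : List ℕ} (A : Matrix (Fin h) (Fin p) ℝ) (b : Fin h → ℝ)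
      (rest : NeuralNetwork q h hs) : NeuralNetwork q p (h :: hs)

/-- The function computed by a network: `x ↦ σ(A x + b)` (componentwise) on each hidden layer and
`x ↦ A x + b` on the output layer. -/
noncomputable def NeuralNetwork.eval (σ : ℝ → ℝ) {q : ℕ} : {p : ℕ} → {hs : List ℕ} →
    NeuralNetwork q p hs → EuclideanSpace ℝ (Fin p) → EuclideanSpace ℝ (Fin q)
  | _, _, .output A b, x => WithLp.toLp 2 (A.mulVec x.ofLp + b)
  | _, _, .hidden A b rest, x =>
      rest.eval σ (WithLp.toLp 2 (fun k => σ ((A.mulVec x.ofLp + b) k)))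

/-- The composition of the first `i` maps of a sequence: `f_i ∘ ⋯ ∘ f_1`, where the entry with
index `i` is the map `f_{i+1} : ℝ^{m_i} → ℝ^{m_{i+1}}`. -/
def composeUpTo {m : ℕ → ℕ}
    (f : (i : ℕ) → EuclideanSpace ℝ (Fin (m i)) → EuclideanSpace ℝ (Fin (m (i + 1)))) :
    (i : ℕ) → EuclideanSpace ℝ (Fin (m 0)) → EuclideanSpace ℝ (Fin (m i))
  | 0 => id
  | i + 1 => f i ∘ composeUpTo f i

/-- `(∫_K ‖F - G‖² dμ)^{1/2} ≤ δ`, the integral being convergent. -/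
def L2Within {n m : ℕ} (μ : MeasureTheory.Measure (EuclideanSpace ℝ (Fin n)))
    (K : Set (EuclideanSpace ℝ (Fin n)))
    (F G : EuclideanSpace ℝ (Fin n) → EuclideanSpace ℝ (Fin m)) (δ : ℝ) : Prop :=
  MeasureTheory.IntegrableOn (fun x => ‖F x - G x‖ ^ 2) K μ ∧
    √(∫ x in K, ‖F x - G x‖ ^ 2 ∂μ) ≤ δ

/-!
One layer. A Barron function is, up to a constant, a mixture of the step functions
`1_{⟨ω, y⟩ > t} - 1/2`, because on `[-N, N]` the function `e^{iu} - cos N` is a superposition of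
centred steps (`integral_centredStep_mul_exp`, `IsBarronOn.exists_stepMixture`). The total mass is at
most `2 c`. Centring the steps has three benefits. The mixture is defined on the whole space, so it
extends the Barron function from `B`; it varies by at most its mass; and the values `±1/2` halve the
usual sampling error: `r` neurons drawn from a mixture of mass `Λ` have mean square error
`Λ² / (4 r)`. For sigmoidal functions one samples sharpened neurons `σ(L ·)` instead, whose mean and
variance tend to those of the steps as `L → ∞`; the loss is absorbed by weakening the bound to
`Λ² / (2 r)` (`exists_sum_sub_mean_sq_le`, `StepMixture.exists_shallow`). With the prescribed numbers
of nodes every layer `f i` then has a global extension `F i` of oscillation at most `R = 2 C √m` that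
is approximated by a network `g i` up to the mean square error `ε² / 2`, whatever the probability
measure (`IsVectorBarronOn.shallowApproximable`, `IsComponentwiseBarronOn.shallowApproximable`).

Composition. Choose `g i` for the distribution of the output of the previous networks, and let `W` be
the sum of the errors `‖F i - g i‖` of the first `l - 1` layers along the trajectory of the network.
Where `W ≤ s`, the trajectory stays within `s` of the true one, hence in the sets on which
`F i = f i`, and the `1`-Lipschitz property bounds the deviation by `W` (`exists_deep_of_margin`).
Where `W > s`, the last step is off by at most `R ≤ R W / s` plus the error of the last layer. So the
squared error is everywhere at most `2 (1 + R² / s²) W²` plus twice the squared error of the last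
layer. Since the mean of `W²` is at most `(l - 1)² ε² / 2`, integration gives
`ε² ((l - 1)² (1 + R² / s²) + 1)`, and the claim follows from `3 (l - 1)² ≤ l³`
(`exists_network_L2Within`).
-/

open MeasureTheory Filter Topology

/-! ### Networks as compositions of shallow networks -/

/-- A one-hidden-layer network with `r` nodes and values in a real vector space, written without
coordinates: `y ↦ κ + ∑ₖ σ(⟨aₖ, y⟩ + bₖ) • wₖ`. -/
def IsShallow (σ : ℝ → ℝ) {n : ℕ} {V : Type*} [AddCommGroup V] [Module ℝ V] (r : ℕ)
    (g : EuclideanSpace ℝ (Fin n) → V) : Prop :=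
  ∃ (a : Fin r → EuclideanSpace ℝ (Fin n)) (b : Fin r → ℝ) (w : Fin r → V) (κ : V),
    ∀ y, g y = κ + ∑ k, σ (inner ℝ (a k) y + b k) • w k

/-- `G` is a composition of `k` one-hidden-layer networks, the `i`th of which has `r i` nodes. -/
def IsDeep (σ : ℝ → ℝ) (m r : ℕ → ℕ) :
    (k : ℕ) → (EuclideanSpace ℝ (Fin (m 0)) → EuclideanSpace ℝ (Fin (m k))) → Prop
  | 0, G => G = id
  | k + 1, G => ∃ (G' : EuclideanSpace ℝ (Fin (m 0)) → EuclideanSpace ℝ (Fin (m k)))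
      (g : EuclideanSpace ℝ (Fin (m k)) → EuclideanSpace ℝ (Fin (m (k + 1)))),
      IsDeep σ m r k G' ∧ IsShallow σ (r k) g ∧ G = g ∘ G'

/-- An affine map in front of a network can be absorbed into its first layer. -/
lemma NeuralNetwork.exists_eval_affine (σ : ℝ → ℝ) {q p p' : ℕ} {hs : List ℕ}
    (N : NeuralNetwork q p hs) (T : Matrix (Fin p) (Fin p') ℝ) (t : Fin p → ℝ) :
    ∃ N' : NeuralNetwork q p' hs, ∀ x,
      N'.eval σ x = N.eval σ (WithLp.toLp 2 (T.mulVec x.ofLp + t)) := by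
  cases N with
  | output A b =>
    refine ⟨.output (A * T) (A.mulVec t + b), fun x => ?_⟩
    simp [NeuralNetwork.eval, Matrix.mulVec_add, add_assoc]
  | hidden A b rest =>
    refine ⟨.hidden (A * T) (A.mulVec t + b) rest, fun x => ?_⟩
    simp [NeuralNetwork.eval, Matrix.mulVec_add, add_assoc]

lemma NeuralNetwork.exists_eval_comp_shallow (σ : ℝ → ℝ) {q p n r : ℕ} {hs : List ℕ}
    (N : NeuralNetwork q p hs) {g : EuclideanSpace ℝ (Fin n) → EuclideanSpace ℝ (Fin p)}
    (hg : IsShallow σ r g) :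
    ∃ N' : NeuralNetwork q n (r :: hs), ∀ x, N'.eval σ x = N.eval σ (g x) := by
  obtain ⟨a, b, w, κ, hg⟩ := hg
  obtain ⟨N₁, hN₁⟩ := N.exists_eval_affine σ (Matrix.of fun i k => w k i) κ.ofLp
  refine ⟨.hidden (Matrix.of fun k i => a k i) b N₁, fun x => ?_⟩
  rw [NeuralNetwork.eval, hN₁]
  congr 1
  ext i
  simp [hg, Matrix.mulVec, dotProduct, PiLp.inner_apply, add_comm, mul_comm]

lemma IsDeep.exists_network_append {σ : ℝ → ℝ} {m r : ℕ → ℕ} {q : ℕ} :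
    ∀ {k : ℕ} {G : EuclideanSpace ℝ (Fin (m 0)) → EuclideanSpace ℝ (Fin (m k))} {hs : List ℕ},
      IsDeep σ m r k G → ∀ N : NeuralNetwork q (m k) hs,
      ∃ N' : NeuralNetwork q (m 0) (List.ofFn (fun i : Fin k => r i) ++ hs),
        ∀ x, N'.eval σ x = N.eval σ (G x)
  | 0, G, hs, hG, N => by
    simp only [IsDeep] at hG
    subst hG
    exact ⟨N, fun x => rfl⟩
  | k + 1, G, hs, hG, N => by
    obtain ⟨G', g, hG', hg, rfl⟩ := hG
    obtain ⟨N₁, hN₁⟩ := N.exists_eval_comp_shallow σ hg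
    obtain ⟨N₂, hN₂⟩ := hG'.exists_network_append N₁
    have hlist : List.ofFn (fun i : Fin (k + 1) => r i) ++ hs =
        List.ofFn (fun i : Fin k => r i) ++ r k :: hs := by
      rw [List.ofFn_succ_last]
      simp
    rw [hlist]
    exact ⟨N₂, fun x => by rw [hN₂, hN₁]; rfl⟩

lemma IsDeep.exists_network {σ : ℝ → ℝ} {m r : ℕ → ℕ} {k : ℕ}
    {G : EuclideanSpace ℝ (Fin (m 0)) → EuclideanSpace ℝ (Fin (m k))} (hG : IsDeep σ m r k G) :
    ∃ N : NeuralNetwork (m k) (m 0) (List.ofFn fun i : Fin k => r i), N.eval σ = G := by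
  have h := hG.exists_network_append (.output (1 : Matrix (Fin (m k)) (Fin (m k)) ℝ) 0)
  rw [List.append_nil] at h
  obtain ⟨N, hN⟩ := h
  refine ⟨N, funext fun x => ?_⟩
  simp [hN, NeuralNetwork.eval]

lemma IsShallow.measurable {σ : ℝ → ℝ} (hσ : Measurable σ) {n r : ℕ} {V : Type*}
    [NormedAddCommGroup V] [NormedSpace ℝ V] [MeasurableSpace V] [BorelSpace V]
    [SecondCountableTopology V] {g : EuclideanSpace ℝ (Fin n) → V} (hg : IsShallow σ r g) :
    Measurable g := by
  obtain ⟨a, b, w, κ, hg⟩ := hg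
  rw [funext hg]
  refine measurable_const.add (Finset.measurable_sum _ fun k _ => ?_)
  exact (hσ.comp (by fun_prop)).smul_const _

lemma IsShallow.exists_norm_le {σ : ℝ → ℝ} (hσ : ∃ M, ∀ t, |σ t| ≤ M) {n r : ℕ} {V : Type*}
    [NormedAddCommGroup V] [NormedSpace ℝ V] {g : EuclideanSpace ℝ (Fin n) → V}
    (hg : IsShallow σ r g) : ∃ R, ∀ y, ‖g y‖ ≤ R := by
  obtain ⟨M, hM⟩ := hσ
  obtain ⟨a, b, w, κ, hg⟩ := hg
  refine ⟨‖κ‖ + ∑ k, M * ‖w k‖, fun y => ?_⟩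
  rw [hg]
  refine (norm_add_le _ _).trans (add_le_add_right ((norm_sum_le _ _).trans ?_) _)
  refine Finset.sum_le_sum fun k _ => ?_
  rw [norm_smul]
  exact mul_le_mul_of_nonneg_right (hM _) (norm_nonneg _)

/-- Scalar networks with `r` nodes each, placed side by side, form a network with `m * r` nodes. -/
lemma IsShallow.pi {σ : ℝ → ℝ} {n m r : ℕ} {g : Fin m → EuclideanSpace ℝ (Fin n) → ℝ}
    (hg : ∀ j, IsShallow σ r (g j)) :
    IsShallow σ (m * r) (fun y => (WithLp.toLp 2 fun j => g j y : EuclideanSpace ℝ (Fin m))) := by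
  choose a b w κ hg using hg
  let e : Fin (m * r) ≃ Fin m × Fin r := finProdFinEquiv.symm
  refine ⟨fun k => a (e k).1 (e k).2, fun k => b (e k).1 (e k).2,
    fun k => EuclideanSpace.single (e k).1 (w (e k).1 (e k).2), WithLp.toLp 2 κ, fun y => ?_⟩
  rw [Equiv.sum_comp e fun q : Fin m × Fin r =>
    σ (inner ℝ (a q.1 q.2) y + b q.1 q.2) • EuclideanSpace.single q.1 (w q.1 q.2)]
  ext j
  simp [hg, Fintype.sum_prod_type, Pi.single_apply, Finset.sum_ite_irrel]

/-! ### Maurey's sampling lemma -/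

/-- One step of the sampling argument: the mixed term vanishes on average. -/
lemma integral_norm_add_sub_mean_sq_le {P V : Type*} [MeasurableSpace P] [NormedAddCommGroup V]
    [InnerProductSpace ℝ V] [CompleteSpace V] (lam : Measure P) [IsProbabilityMeasure lam]
    {ξ : P → V} (hξ : MemLp ξ 2 lam) (a : V) :
    ∫ q, ‖a + (ξ q - ∫ q', ξ q' ∂lam)‖ ^ 2 ∂lam ≤ ‖a‖ ^ 2 + ∫ q, ‖ξ q‖ ^ 2 ∂lam := by
  set m := ∫ q', ξ q' ∂lam with hm
  have hint : Integrable ξ lam := hξ.integrable one_le_two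
  have hsq : Integrable (fun q => ‖ξ q‖ ^ 2) lam := hξ.integrable_norm_pow two_ne_zero
  have hinner : Integrable (fun q => 2 * inner ℝ (a - m) (ξ q)) lam :=
    (hint.const_inner (a - m)).const_mul 2
  have hexp : ∀ q, ‖a + (ξ q - m)‖ ^ 2 =
      ‖a - m‖ ^ 2 + 2 * inner ℝ (a - m) (ξ q) + ‖ξ q‖ ^ 2 := fun q => by
    rw [← norm_add_sq_real]
    congr 2
    abel
  simp_rw [hexp]
  have hlin : Integrable (fun q => ‖a - m‖ ^ 2 + 2 * inner ℝ (a - m) (ξ q)) lam :=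
    (integrable_const _).add hinner
  rw [integral_add hlin hsq, integral_add (integrable_const _) hinner, integral_const_mul,
    integral_inner hint, ← hm]
  have h1 : ‖a‖ ^ 2 = ‖a - m‖ ^ 2 + 2 * inner ℝ (a - m) m + ‖m‖ ^ 2 := by
    rw [← norm_add_sq_real, sub_add_cancel]
  simp only [integral_const, probReal_univ, one_smul]
  nlinarith [sq_nonneg ‖m‖]

/-- Maurey's sampling lemma: `r` points can be chosen so that the deviations of the corresponding
random functions from their mean add up like independent errors. The points are chosen one after
the other, each at most as bad as the average choice. -/
lemma exists_sum_sub_mean_sq_le {P Ω V : Type*} [MeasurableSpace P] [MeasurableSpace Ω]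
    [NormedAddCommGroup V] [InnerProductSpace ℝ V] [CompleteSpace V]
    (lam : Measure P) [IsProbabilityMeasure lam] (μ : Measure Ω) [IsProbabilityMeasure μ]
    {ξ : P → Ω → V} (hξ : StronglyMeasurable (Function.uncurry ξ)) {R : ℝ}
    (hR : ∀ p y, ‖ξ p y‖ ≤ R) (r : ℕ) :
    ∃ p : Fin r → P, ∫ y, ‖∑ k, (ξ (p k) y - ∫ q, ξ q y ∂lam)‖ ^ 2 ∂μ ≤
      r * ∫ y, ∫ q, ‖ξ q y‖ ^ 2 ∂lam ∂μ := by
  set m : Ω → V := fun y => ∫ q, ξ q y ∂lam with hm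
  have hmm : StronglyMeasurable m := hξ.integral_prod_left
  have hmR : ∀ y, ‖m y‖ ≤ R := fun y => by
    simpa using norm_integral_le_of_norm_le_const (μ := lam) (ae_of_all _ fun q => hR q y)
  have hsec : ∀ q, StronglyMeasurable (ξ q) := fun q => hξ.comp_measurable measurable_prodMk_left
  have hsec' : ∀ y, StronglyMeasurable fun q => ξ q y := fun y =>
    hξ.comp_measurable measurable_prodMk_right
  induction r with
  | zero => exact ⟨Fin.elim0, by simp⟩
  | succ r ih =>
    obtain ⟨p, hp⟩ := ih
    set a : Ω → V := fun y => ∑ k, (ξ (p k) y - m y) with ha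
    have ham : StronglyMeasurable a :=
      Finset.stronglyMeasurable_fun_sum _ fun k _ => (hsec (p k)).sub hmm
    have haR : ∀ y, ‖a y‖ ≤ r * (R + R) := fun y => by
      refine (norm_sum_le _ _).trans ((Finset.sum_le_sum fun k _ =>
        (norm_sub_le _ _).trans (add_le_add (hR (p k) y) (hmR y))).trans ?_)
      simp [mul_add]
    have hΦm : StronglyMeasurable (fun z : P × Ω => ‖a z.2 + (ξ z.1 z.2 - m z.2)‖ ^ 2) :=
      ((ham.comp_measurable measurable_snd).add
        (hξ.sub (hmm.comp_measurable measurable_snd))).norm.pow 2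
    have hΦR : ∀ z : P × Ω, ‖‖a z.2 + (ξ z.1 z.2 - m z.2)‖ ^ 2‖ ≤ (r * (R + R) + (R + R)) ^ 2 :=
      fun z => by
        rw [norm_pow, norm_norm]
        exact pow_le_pow_left₀ (norm_nonneg _) ((norm_add_le _ _).trans (add_le_add (haR _)
          ((norm_sub_le _ _).trans (add_le_add (hR _ _) (hmR _))))) 2
    have hΦ : Integrable (fun z : P × Ω => ‖a z.2 + (ξ z.1 z.2 - m z.2)‖ ^ 2) (lam.prod μ) :=
      Integrable.of_bound hΦm.aestronglyMeasurable _ (ae_of_all _ hΦR)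
    obtain ⟨q, hq⟩ := exists_le_integral hΦ.integral_prod_left
    refine ⟨Fin.snoc p q, ?_⟩
    have hsum : ∀ y, ∑ k, (ξ ((Fin.snoc p q : Fin (r + 1) → P) k) y - ∫ q, ξ q y ∂lam) =
        a y + (ξ q y - m y) := fun y => by
      rw [Fin.sum_univ_castSucc]
      simp only [Fin.snoc_castSucc, Fin.snoc_last]
      rfl
    simp only [hsum]
    refine (show ∫ y, ‖a y + (ξ q y - m y)‖ ^ 2 ∂μ ≤
      ∫ q, ∫ y, ‖a y + (ξ q y - m y)‖ ^ 2 ∂μ ∂lam from hq).trans ?_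
    rw [integral_integral_swap hΦ]
    have hsqm : StronglyMeasurable fun z : P × Ω => ‖ξ z.1 z.2‖ ^ 2 := hξ.norm.pow 2
    have hsq : Integrable (fun z : P × Ω => ‖ξ z.1 z.2‖ ^ 2) (lam.prod μ) :=
      Integrable.of_bound hsqm.aestronglyMeasurable (R ^ 2) (ae_of_all _ fun z => by
        rw [norm_pow, norm_norm]
        exact pow_le_pow_left₀ (norm_nonneg _) (hR _ _) 2)
    have haint : Integrable (fun y => ‖a y‖ ^ 2) μ :=
      Integrable.of_bound (ham.norm.pow 2).aestronglyMeasurable ((r * (R + R)) ^ 2)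
        (ae_of_all _ fun y => by
          rw [norm_pow, norm_norm]
          exact pow_le_pow_left₀ (norm_nonneg _) (haR _) 2)
    calc ∫ y, ∫ q, ‖a y + (ξ q y - m y)‖ ^ 2 ∂lam ∂μ
        ≤ ∫ y, (‖a y‖ ^ 2 + ∫ q, ‖ξ q y‖ ^ 2 ∂lam) ∂μ := by
          refine integral_mono hΦ.integral_prod_right (haint.add hsq.integral_prod_right)
            fun y => integral_norm_add_sub_mean_sq_le lam ?_ (a y)
          exact MemLp.of_bound (hsec' y).aestronglyMeasurable R (ae_of_all _ fun q => hR q y)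
      _ = ∫ y, ‖a y‖ ^ 2 ∂μ + ∫ y, ∫ q, ‖ξ q y‖ ^ 2 ∂lam ∂μ :=
          integral_add haint hsq.integral_prod_right
      _ ≤ _ := by push_cast; linarith

/-! ### Mixtures of step functions -/

/-- The step function `1_{(0, ∞)}`, recentred to take the values `±1/2`. -/
noncomputable def centredStep (u : ℝ) : ℝ := if 0 < u then 1 / 2 else -(1 / 2)

lemma measurable_centredStep : Measurable centredStep :=
  Measurable.ite measurableSet_Ioi measurable_const measurable_const

lemma abs_centredStep (u : ℝ) : |centredStep u| = 1 / 2 := by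
  unfold centredStep
  split_ifs <;> norm_num

lemma IsSigmoidal.tendsto_scaled {σ : ℝ → ℝ} (hσ : IsSigmoidal σ) {u : ℝ} (hu : u ≠ 0) :
    Tendsto (fun L : ℕ => σ (L * u) - 1 / 2) atTop (𝓝 (centredStep u)) := by
  have hL : Tendsto (fun L : ℕ => (L : ℝ)) atTop atTop := tendsto_natCast_atTop_atTop
  unfold centredStep
  split_ifs with h
  · have h1 := (hσ.tendsto_atTop.comp (hL.atTop_mul_const h)).sub_const (1 / 2)
    norm_num at h1 ⊢
    exact h1
  · have h1 := (hσ.tendsto_atBot.comp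
      (hL.atTop_mul_const_of_neg (lt_of_le_of_ne (not_lt.1 h) hu))).sub_const (1 / 2)
    norm_num at h1 ⊢
    exact h1

/-- A continuous mixture of step functions on `ℝⁿ`: a finite measure on a parameter space `P`,
whose point `p` carries the half-space `⟨ω p, y⟩ > t p` and a vector `v p` of norm at most `1`.
Each point of `ℝⁿ` lies on almost none of the bounding hyperplanes. -/
structure StepMixture (n : ℕ) (P V : Type*) [MeasurableSpace P] [NormedAddCommGroup V] where
  /-- The weights of the parameters. -/
  law : Measure P
  finite : IsFiniteMeasure law
  /-- The normal vectors of the half-spaces. -/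
  ω : P → EuclideanSpace ℝ (Fin n)
  /-- The thresholds of the half-spaces. -/
  t : P → ℝ
  /-- The values of the steps. -/
  v : P → V
  measurable_ω : Measurable ω
  measurable_t : Measurable t
  stronglyMeasurable_v : StronglyMeasurable v
  norm_v_le : ∀ p, ‖v p‖ ≤ 1
  ae_ne : ∀ y, ∀ᵐ p ∂law, inner ℝ (ω p) y ≠ t p

namespace StepMixture

variable {n : ℕ} {P V : Type*} [MeasurableSpace P] [NormedAddCommGroup V]

attribute [instance] StepMixture.finite

lemma measurable_arg (S : StepMixture n P V) :
    Measurable fun z : P × EuclideanSpace ℝ (Fin n) => inner ℝ (S.ω z.1) z.2 - S.t z.1 :=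
  ((S.measurable_ω.comp measurable_fst).inner measurable_snd).sub
    (S.measurable_t.comp measurable_fst)

/-- The mean square of the sharpened sigmoidal neurons tends to that of the centred steps. -/
lemma tendsto_integral_neuron_sq {σ : ℝ → ℝ} (hσ : IsSigmoidal σ) (S : StepMixture n P V)
    (y : EuclideanSpace ℝ (Fin n)) :
    Tendsto (fun L : ℕ => ∫ p, (σ (L * (inner ℝ (S.ω p) y - S.t p)) - 1 / 2) ^ 2 ∂S.law)
      atTop (𝓝 (S.law.real Set.univ / 4)) := by
  obtain ⟨M, hM⟩ := hσ.bounded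
  have h4 : S.law.real Set.univ / 4 =
      ∫ p, centredStep (inner ℝ (S.ω p) y - S.t p) ^ 2 ∂S.law := by
    have : ∀ u, centredStep u ^ 2 = 1 / 4 := fun u => by
      rw [← sq_abs, abs_centredStep]
      norm_num
    simp [this, div_eq_mul_inv]
  rw [h4]
  refine tendsto_integral_of_dominated_convergence (fun _ => (M + 1 / 2) ^ 2) (fun L => ?_)
    (integrable_const _) (fun L => ae_of_all _ fun p => ?_) ?_
  · have hm : Measurable fun u => (σ (L * u) - 1 / 2) ^ 2 :=
      ((hσ.measurable.comp (measurable_const_mul _)).sub_const _).pow_const 2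
    exact ((hm.comp S.measurable_arg).comp measurable_prodMk_right).aestronglyMeasurable
  · rw [norm_pow]
    exact pow_le_pow_left₀ (norm_nonneg _)
      ((abs_sub _ _).trans (add_le_add (hM _) (by norm_num))) 2
  · filter_upwards [S.ae_ne y] with p hp
    exact (hσ.tendsto_scaled (sub_ne_zero.2 hp)).pow 2

variable [NormedSpace ℝ V]

/-- The function `y ↦ ∫ (1_{⟨ω, y⟩ > t} - 1/2) v` represented by a mixture. -/
noncomputable def eval (S : StepMixture n P V) (y : EuclideanSpace ℝ (Fin n)) : V :=
  ∫ p, centredStep (inner ℝ (S.ω p) y - S.t p) • S.v p ∂S.law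

lemma stronglyMeasurable_neuron (S : StepMixture n P V) {τ : ℝ → ℝ} (hτ : Measurable τ) :
    StronglyMeasurable fun z : P × EuclideanSpace ℝ (Fin n) =>
      τ (inner ℝ (S.ω z.1) z.2 - S.t z.1) • S.v z.1 :=
  (hτ.comp S.measurable_arg).stronglyMeasurable.smul
    (S.stronglyMeasurable_v.comp_measurable measurable_fst)

lemma norm_neuron_le (S : StepMixture n P V) {τ : ℝ → ℝ} {R : ℝ} (hR : ∀ u, |τ u| ≤ R)
    (u : ℝ) (p : P) : ‖τ u • S.v p‖ ≤ R := by
  rw [norm_smul]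
  exact (mul_le_of_le_one_right (norm_nonneg _) (S.norm_v_le p)).trans (hR u)

lemma stronglyMeasurable_eval (S : StepMixture n P V) : StronglyMeasurable S.eval :=
  (S.stronglyMeasurable_neuron measurable_centredStep).integral_prod_left'

lemma norm_eval_le (S : StepMixture n P V) (y : EuclideanSpace ℝ (Fin n)) :
    ‖S.eval y‖ ≤ S.law.real Set.univ / 2 := by
  have := norm_integral_le_of_norm_le_const (μ := S.law) (C := 1 / 2)
    (f := fun p => centredStep (inner ℝ (S.ω p) y - S.t p) • S.v p)
    (ae_of_all _ fun p => S.norm_neuron_le (fun u => (abs_centredStep u).le) _ p)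
  rw [eval]
  linarith

lemma norm_eval_sub_eval_le (S : StepMixture n P V) (y y' : EuclideanSpace ℝ (Fin n)) :
    ‖S.eval y - S.eval y'‖ ≤ S.law.real Set.univ := by
  linarith [norm_sub_le (S.eval y) (S.eval y'), S.norm_eval_le y, S.norm_eval_le y']

/-- The average of the sharpened sigmoidal neurons tends to the mixture of steps. -/
lemma tendsto_integral_neuron {σ : ℝ → ℝ} (hσ : IsSigmoidal σ) (S : StepMixture n P V)
    (y : EuclideanSpace ℝ (Fin n)) :
    Tendsto (fun L : ℕ => ∫ p, (σ (L * (inner ℝ (S.ω p) y - S.t p)) - 1 / 2) • S.v p ∂S.law)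
      atTop (𝓝 (S.eval y)) := by
  obtain ⟨M, hM⟩ := hσ.bounded
  refine tendsto_integral_of_dominated_convergence (fun _ => M + 1 / 2) (fun L => ?_)
    (integrable_const _) (fun L => ae_of_all _ fun p => ?_) ?_
  · exact ((S.stronglyMeasurable_neuron (τ := fun u => σ (L * u) - 1 / 2)
      ((hσ.measurable.comp (measurable_const_mul _)).sub_const _)).comp_measurable
      measurable_prodMk_right).aestronglyMeasurable
  · refine S.norm_neuron_le (τ := fun u => σ (L * u) - 1 / 2) (fun u => ?_) _ p
    exact (abs_sub _ _).trans (add_le_add (hM _) (by norm_num))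
  · filter_upwards [S.ae_ne y] with p hp
    exact (hσ.tendsto_scaled (sub_ne_zero.2 hp)).smul_const _

end StepMixture

lemma norm_add_sq_le_three_mul {V : Type*} [SeminormedAddCommGroup V] (a b : V) :
    ‖a + b‖ ^ 2 ≤ 3 * ‖a‖ ^ 2 + 3 / 2 * ‖b‖ ^ 2 := by
  nlinarith [norm_add_le a b, norm_nonneg (a + b), norm_nonneg a, norm_nonneg b,
    sq_nonneg (2 * ‖a‖ - ‖b‖)]

/-- Sampling `r` neurons from a mixture of steps of total mass `Λ` approximates it up to a mean
square error of about `Λ² / (4 r)`, because centred steps have absolute value `1/2`. The factor `2`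
left in the hypothesis pays for replacing the steps by sigmoidal functions. -/
theorem StepMixture.exists_shallow {n : ℕ} {P V : Type*} [MeasurableSpace P]
    [NormedAddCommGroup V] [InnerProductSpace ℝ V] [CompleteSpace V]
    {σ : ℝ → ℝ} (hσ : IsSigmoidal σ) (S : StepMixture n P V) {ρ : ℝ} (hρ : 0 < ρ) {r : ℕ}
    (hr : S.law.real Set.univ ^ 2 / 2 ≤ ρ * r)
    (μ : Measure (EuclideanSpace ℝ (Fin n))) [IsProbabilityMeasure μ] :
    ∃ g : EuclideanSpace ℝ (Fin n) → V, IsShallow σ r g ∧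
      ∫ y, ‖S.eval y - g y‖ ^ 2 ∂μ ≤ ρ := by
  obtain ⟨M, hM⟩ := hσ.bounded
  set Λ := S.law.real Set.univ with hΛ
  rcases (measureReal_nonneg (μ := S.law) (s := Set.univ)).eq_or_lt with h0 | hpos
  · have hz : ∀ y, S.eval y = 0 := fun y => by
      have := S.norm_eval_le y
      rw [← h0, zero_div] at this
      exact norm_le_zero_iff.1 this
    exact ⟨fun _ => 0, ⟨0, 0, 0, 0, by simp⟩, by simpa [hz] using hρ.le⟩
  rw [← hΛ] at hpos
  have hr0 : (0 : ℝ) < r := by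
    by_contra h
    have : (r : ℝ) = 0 := le_antisymm (not_lt.1 h) r.cast_nonneg
    rw [this] at hr
    nlinarith [pow_pos hpos 2]
  have hne : S.law ≠ 0 := fun h => by simp [hΛ, h] at hpos
  -- the sampling distribution is the normalized law of the mixture
  set lam : Measure P := (S.law Set.univ)⁻¹ • S.law with hlam
  have : NeZero S.law := ⟨hne⟩
  have : IsProbabilityMeasure lam := isProbabilityMeasureSMul
  let ξ : ℕ → P → EuclideanSpace ℝ (Fin n) → V := fun L p y =>
    (σ (L * (inner ℝ (S.ω p) y - S.t p)) - 1 / 2) • S.v p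
  have hτ : ∀ L : ℕ, Measurable fun u => σ (L * u) - 1 / 2 := fun L =>
    (hσ.measurable.comp (measurable_const_mul _)).sub_const _
  have hτM : ∀ (L : ℕ) (u : ℝ), |σ (L * u) - 1 / 2| ≤ M + 1 / 2 := fun L u =>
    (abs_sub _ _).trans (add_le_add (hM _) (by norm_num))
  have hξm : ∀ L, StronglyMeasurable (Function.uncurry (ξ L)) := fun L =>
    S.stronglyMeasurable_neuron (hτ L)
  have hξR : ∀ L p y, ‖ξ L p y‖ ≤ M + 1 / 2 := fun L p y => S.norm_neuron_le (hτM L) _ p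
  let F : ℕ → EuclideanSpace ℝ (Fin n) → V := fun L y => ∫ p, ξ L p y ∂S.law
  have hFm : ∀ L, StronglyMeasurable (F L) := fun L => (hξm L).integral_prod_left
  have hFR : ∀ L y, ‖F L y‖ ≤ (M + 1 / 2) * Λ := fun L y =>
    norm_integral_le_of_norm_le_const (ae_of_all _ fun p => hξR L p y)
  have hbias : Tendsto (fun L => ∫ y, ‖S.eval y - F L y‖ ^ 2 ∂μ) atTop (𝓝 0) := by
    rw [← integral_zero (EuclideanSpace ℝ (Fin n)) ℝ (μ := μ)]
    refine tendsto_integral_of_dominated_convergence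
      (fun _ => (Λ / 2 + (M + 1 / 2) * Λ) ^ 2) (fun L => ?_) (integrable_const _)
      (fun L => ae_of_all _ fun y => ?_) (ae_of_all _ fun y => ?_)
    · exact ((S.stronglyMeasurable_eval.sub (hFm L)).norm.pow 2).aestronglyMeasurable
    · rw [norm_pow, norm_norm]
      exact pow_le_pow_left₀ (norm_nonneg _)
        ((norm_sub_le _ _).trans (add_le_add (S.norm_eval_le y) (hFR L y))) 2
    · simpa only [sub_self, norm_zero, zero_pow two_ne_zero] using
        ((S.tendsto_integral_neuron hσ y).const_sub (S.eval y)).norm.pow 2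
  have hvar : Tendsto (fun L : ℕ => ∫ y, ∫ p,
      (σ (L * (inner ℝ (S.ω p) y - S.t p)) - 1 / 2) ^ 2 ∂S.law ∂μ) atTop (𝓝 (Λ / 4)) := by
    have hconst : Λ / 4 = ∫ _ : EuclideanSpace ℝ (Fin n), Λ / 4 ∂μ := by simp
    rw [hconst]
    refine tendsto_integral_of_dominated_convergence (fun _ => (M + 1 / 2) ^ 2 * Λ)
      (fun L => ?_) (integrable_const _) (fun L => ae_of_all _ fun y => ?_)
      (ae_of_all _ fun y => S.tendsto_integral_neuron_sq hσ y)
    · exact (((hτ L).pow_const 2).comp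
        S.measurable_arg).stronglyMeasurable.integral_prod_left'.aestronglyMeasurable
    · refine norm_integral_le_of_norm_le_const (ae_of_all _ fun p => ?_)
      rw [norm_pow]
      exact pow_le_pow_left₀ (norm_nonneg _) (hτM L _) 2
  -- the limit is `3/4` of `Λ² / (2 r)`, hence below `ρ`: some finite sharpness `L` suffices
  have hlim : 3 * 0 + 3 / 2 * (Λ ^ 2 / r * (Λ⁻¹ * (Λ / 4))) < ρ := by
    have h1 : 3 * 0 + 3 / 2 * (Λ ^ 2 / r * (Λ⁻¹ * (Λ / 4))) = 3 / 4 * (Λ ^ 2 / 2 / r) := by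
      field_simp
      ring
    have h2 : Λ ^ 2 / 2 / r ≤ ρ := (div_le_iff₀ hr0).2 hr
    have h3 : 0 < Λ ^ 2 / 2 / r := by positivity
    rw [h1]
    linarith
  obtain ⟨L, hL⟩ := (((hbias.const_mul 3).add
    (((hvar.const_mul Λ⁻¹).const_mul (Λ ^ 2 / r)).const_mul (3 / 2))).eventually_lt_const
      hlim).exists
  obtain ⟨p, hp⟩ := exists_sum_sub_mean_sq_le lam μ (hξm L) (hξR L) r
  have hmean : ∀ y, ∫ q, ξ L q y ∂lam = Λ⁻¹ • F L y := fun y => average_eq S.law _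
  simp only [hmean] at hp
  have hsq : ∫ y, ∫ q, ‖ξ L q y‖ ^ 2 ∂lam ∂μ ≤
      Λ⁻¹ * ∫ y, ∫ p, (σ (L * (inner ℝ (S.ω p) y - S.t p)) - 1 / 2) ^ 2 ∂S.law ∂μ := by
    rw [← integral_const_mul]
    refine integral_mono_of_nonneg (ae_of_all _ fun y => integral_nonneg fun q => by positivity)
      (Integrable.const_mul ?_ _) (ae_of_all _ fun y => ?_)
    · refine Integrable.of_bound (((hτ L).pow_const 2).comp
        S.measurable_arg).stronglyMeasurable.integral_prod_left'.aestronglyMeasurable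
        ((M + 1 / 2) ^ 2 * Λ) (ae_of_all _ fun y => ?_)
      refine norm_integral_le_of_norm_le_const (ae_of_all _ fun p => ?_)
      rw [norm_pow]
      exact pow_le_pow_left₀ (norm_nonneg _) (hτM L _) 2
    · refine (average_eq S.law fun q => ‖ξ L q y‖ ^ 2).trans_le
        (mul_le_mul_of_nonneg_left ?_ (inv_nonneg.2 hpos.le))
      refine integral_mono_of_nonneg (ae_of_all _ fun q => by positivity) ?_
        (ae_of_all _ fun q => ?_)
      · refine Integrable.of_bound ((((hτ L).pow_const 2).comp
          S.measurable_arg).comp measurable_prodMk_right).aestronglyMeasurable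
          ((M + 1 / 2) ^ 2) (ae_of_all _ fun p => ?_)
        rw [norm_pow]
        exact pow_le_pow_left₀ (norm_nonneg _) (hτM L _) 2
      · simp only [ξ, norm_smul, mul_pow, Real.norm_eq_abs, sq_abs]
        exact mul_le_of_le_one_right (sq_nonneg _)
          (pow_le_one₀ (norm_nonneg _) (S.norm_v_le q))
  set D : EuclideanSpace ℝ (Fin n) → V := fun y => ∑ k, (ξ L (p k) y - Λ⁻¹ • F L y) with hD
  have hDm : StronglyMeasurable D := Finset.stronglyMeasurable_fun_sum _ fun k _ =>
    ((hξm L).comp_measurable measurable_prodMk_left).sub ((hFm L).const_smul _)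
  have hDR : ∀ y, ‖D y‖ ≤ ∑ _k : Fin r, (M + 1 / 2 + ‖Λ⁻¹‖ * ((M + 1 / 2) * Λ)) := fun y => by
    refine (norm_sum_le _ _).trans (Finset.sum_le_sum fun k _ => (norm_sub_le _ _).trans
      (add_le_add (hξR L _ y) ?_))
    rw [norm_smul]
    exact mul_le_mul_of_nonneg_left (hFR L y) (norm_nonneg _)
  refine ⟨fun y => ∑ k, (Λ / r) • ξ L (p k) y, ⟨fun k => (L : ℝ) • S.ω (p k),
    fun k => -(L * S.t (p k)), fun k => (Λ / r) • S.v (p k),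
    -∑ k, ((Λ / r) * (1 / 2)) • S.v (p k), fun y => ?_⟩, ?_⟩
  · rw [neg_add_eq_sub, ← Finset.sum_sub_distrib]
    refine Finset.sum_congr rfl fun k _ => ?_
    have harg : inner ℝ ((L : ℝ) • S.ω (p k)) y + -(L * S.t (p k)) =
        L * (inner ℝ (S.ω (p k)) y - S.t (p k)) := by
      rw [real_inner_smul_left]
      ring
    rw [harg]
    simp only [ξ, smul_smul, ← sub_smul]
    congr 1
    ring
  -- the error splits into the bias of the sharpened mean and the sampling error
  have hdecomp : ∀ y, S.eval y - ∑ k, (Λ / r) • ξ L (p k) y =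
      (S.eval y - F L y) + -((Λ / r) • D y) := fun y => by
    have hc : (Λ / r) • (r : ℝ) • Λ⁻¹ • F L y = F L y := by
      rw [smul_smul, smul_smul]
      have : Λ / r * r * Λ⁻¹ = 1 := by field_simp
      rw [this, one_smul]
    simp only [hD, Finset.sum_sub_distrib, Finset.sum_const, Finset.card_univ, Fintype.card_fin,
      smul_sub, ← Nat.cast_smul_eq_nsmul ℝ, hc, Finset.smul_sum]
    abel
  have hint1 : Integrable (fun y => ‖S.eval y - F L y‖ ^ 2) μ :=
    Integrable.of_bound ((S.stronglyMeasurable_eval.sub (hFm L)).norm.pow 2).aestronglyMeasurable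
      ((Λ / 2 + (M + 1 / 2) * Λ) ^ 2) (ae_of_all _ fun y => by
        rw [norm_pow, norm_norm]
        exact pow_le_pow_left₀ (norm_nonneg _)
          ((norm_sub_le _ _).trans (add_le_add (S.norm_eval_le y) (hFR L y))) 2)
  have hint2 : Integrable (fun y => ‖D y‖ ^ 2) μ :=
    Integrable.of_bound (hDm.norm.pow 2).aestronglyMeasurable _ (ae_of_all _ fun y => by
      rw [norm_pow, norm_norm]
      exact pow_le_pow_left₀ (norm_nonneg _) (hDR y) 2)
  calc ∫ y, ‖S.eval y - ∑ k, (Λ / r) • ξ L (p k) y‖ ^ 2 ∂μ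
      ≤ ∫ y, (3 * ‖S.eval y - F L y‖ ^ 2 + 3 / 2 * ((Λ / r) ^ 2 * ‖D y‖ ^ 2)) ∂μ := by
        refine integral_mono_of_nonneg (ae_of_all _ fun y => by positivity)
          ((hint1.const_mul 3).add ((hint2.const_mul _).const_mul _)) (ae_of_all _ fun y => ?_)
        simp only [hdecomp]
        refine (norm_add_sq_le_three_mul _ _).trans_eq ?_
        rw [norm_neg, norm_smul, mul_pow, Real.norm_eq_abs, sq_abs]
    _ = 3 * ∫ y, ‖S.eval y - F L y‖ ^ 2 ∂μ + 3 / 2 * ((Λ / r) ^ 2 * ∫ y, ‖D y‖ ^ 2 ∂μ) := by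
        rw [integral_add (hint1.const_mul 3) ((hint2.const_mul _).const_mul _)]
        simp only [integral_const_mul]
    _ ≤ _ := by
        refine le_trans ?_ hL.le
        have h1 : (Λ / r) ^ 2 * ∫ y, ‖D y‖ ^ 2 ∂μ ≤ (Λ / r) ^ 2 * (r * _) :=
          mul_le_mul_of_nonneg_left (hp.trans (mul_le_mul_of_nonneg_left hsq r.cast_nonneg))
            (sq_nonneg _)
        have h2 : ∀ X : ℝ, (Λ / r) ^ 2 * (r * X) = Λ ^ 2 / r * X := fun X => by
          field_simp
        rw [h2] at h1
        linarith

/-! ### Barron's representation by step functions -/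

section SetNorm

variable {n : ℕ} {B : Set (EuclideanSpace ℝ (Fin n))}

lemma setNorm_nonneg (B : Set (EuclideanSpace ℝ (Fin n))) (ω : EuclideanSpace ℝ (Fin n)) :
    0 ≤ setNorm B ω := by
  refine Real.sSup_nonneg ?_
  rintro _ ⟨x, -, rfl⟩
  exact abs_nonneg _

lemma abs_inner_le_setNorm (hB : Bornology.IsBounded B) {x : EuclideanSpace ℝ (Fin n)}
    (hx : x ∈ B) (ω : EuclideanSpace ℝ (Fin n)) : |inner ℝ ω x| ≤ setNorm B ω := by
  obtain ⟨R, hR⟩ := hB.exists_norm_le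
  refine le_csSup ⟨‖ω‖ * R, ?_⟩ ⟨x, hx, rfl⟩
  rintro _ ⟨z, hz, rfl⟩
  exact (abs_real_inner_le_norm _ _).trans
    (mul_le_mul_of_nonneg_left (hR z hz) (norm_nonneg _))

lemma continuous_setNorm (hB : Bornology.IsBounded B) : Continuous (setNorm B) := by
  rcases B.eq_empty_or_nonempty with rfl | hne
  · have : setNorm (∅ : Set (EuclideanSpace ℝ (Fin n))) = fun _ => 0 := by
      ext ω
      simp [setNorm]
    rw [this]
    exact continuous_const
  obtain ⟨R, hR⟩ := hB.exists_norm_le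
  have hR0 : 0 ≤ R := (norm_nonneg _).trans (hR _ hne.some_mem)
  have : LipschitzWith ⟨R, hR0⟩ (setNorm B) := by
    refine LipschitzWith.of_le_add_mul _ fun ω ω' => ?_
    refine csSup_le (hne.image _) ?_
    rintro _ ⟨x, hx, rfl⟩
    have h1 : inner ℝ ω x = inner ℝ ω' x + inner ℝ (ω - ω') x := by
      rw [← inner_add_left, add_sub_cancel]
    have h2 : |inner ℝ (ω - ω') x| ≤ R * dist ω ω' := by
      rw [dist_eq_norm, mul_comm]
      exact (abs_real_inner_le_norm _ _).trans
        (mul_le_mul_of_nonneg_left (hR x hx) (norm_nonneg _))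
    simp only [h1]
    exact (abs_add_le _ _).trans (add_le_add (abs_inner_le_setNorm hB hx ω') h2)
  exact this.continuous

end SetNorm

lemma continuous_fourierHat {n : ℕ} {g : EuclideanSpace ℝ (Fin n) → ℝ} (hg : Integrable g) :
    Continuous (fourierHat g) := by
  refine continuous_const.mul ?_
  refine continuous_of_dominated (bound := fun x => ‖g x‖) (fun ω => ?_)
    (fun ω => ae_of_all _ fun x => ?_) hg.norm (ae_of_all _ fun x => by fun_prop)
  · exact (Complex.continuous_ofReal.comp_aestronglyMeasurable hg.1).mul
      (Continuous.aestronglyMeasurable (by fun_prop))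
  · have : -(Complex.I * (inner ℝ ω x : ℝ)) = ((-inner ℝ ω x : ℝ) : ℂ) * Complex.I := by
      push_cast
      ring
    rw [norm_mul, this, Complex.norm_exp_ofReal_mul_I, mul_one, Complex.norm_real]

/-- On `[-N, N]` the function `e^{iu}` is, up to a constant, a superposition of centred steps. -/
lemma integral_centredStep_mul_exp {N u : ℝ} (hu : |u| ≤ N) :
    ∫ τ in Set.Icc (-1 : ℝ) 1, (centredStep (u - N * τ) : ℂ) *
        (Complex.I * N * Complex.exp (Complex.I * (N * τ : ℝ))) =
      Complex.exp (Complex.I * u) - Real.cos N := by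
  have hN : 0 ≤ N := (abs_nonneg u).trans hu
  rcases hN.eq_or_lt with rfl | hN
  · have : u = 0 := abs_nonpos_iff.1 hu
    simp [this]
  rw [abs_le] at hu
  set E : ℝ → ℂ := fun τ => Complex.exp (Complex.I * (N * τ : ℝ)) with hE
  set h : ℝ → ℂ := fun τ => Complex.I * N * E τ with hh
  have hcont : Continuous h := by fun_prop
  have hderiv : ∀ τ : ℝ, HasDerivAt E (h τ) τ := fun τ => by
    have h1 : HasDerivAt (fun τ : ℝ => Complex.I * (N * τ : ℝ)) (Complex.I * N) τ := by
      have := (((hasDerivAt_id τ).const_mul N).ofReal_comp).const_mul Complex.I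
      simpa using this
    convert h1.cexp using 1
    simp only [hh, hE]
    ring
  have hFTC : ∀ a b : ℝ, ∫ τ in a..b, h τ = E b - E a := fun a b =>
    intervalIntegral.integral_eq_sub_of_hasDerivAt (fun τ _ => hderiv τ)
      (hcont.intervalIntegrable _ _)
  have hl : -1 ≤ u / N := by rw [le_div_iff₀ hN]; linarith
  have hr : u / N ≤ 1 := by rw [div_le_iff₀ hN]; linarith
  have h1 : Set.EqOn (fun τ => (centredStep (u - N * τ) : ℂ) * h τ)
      (fun τ => (1 / 2 : ℂ) * h τ) (Set.Ioo (-1) (u / N)) := fun τ hτ => by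
    have : 0 < u - N * τ := by
      have := (lt_div_iff₀ hN).1 hτ.2
      linarith
    simp [centredStep, this]
  have h2 : Set.EqOn (fun τ => (centredStep (u - N * τ) : ℂ) * h τ)
      (fun τ => (-(1 / 2) : ℂ) * h τ) (Set.Ioc (u / N) 1) := fun τ hτ => by
    have : ¬ 0 < u - N * τ := by
      have := (div_lt_iff₀ hN).1 hτ.1
      linarith
    simp [centredStep, this]
  have hI1 : IntegrableOn (fun τ => (centredStep (u - N * τ) : ℂ) * h τ)
      (Set.Ioc (-1) (u / N)) := by
    rw [integrableOn_Ioc_iff_integrableOn_Ioo]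
    exact ((hcont.const_mul _).integrableOn_Icc.mono_set Set.Ioo_subset_Icc_self).congr_fun
      h1.symm measurableSet_Ioo
  have hI2 : IntegrableOn (fun τ => (centredStep (u - N * τ) : ℂ) * h τ)
      (Set.Ioc (u / N) 1) :=
    ((hcont.const_mul _).integrableOn_Ioc).congr_fun h2.symm measurableSet_Ioc
  rw [integral_Icc_eq_integral_Ioc, ← Set.Ioc_union_Ioc_eq_Ioc hl hr,
    setIntegral_union (Set.Ioc_disjoint_Ioc_of_le le_rfl) measurableSet_Ioc hI1 hI2,
    integral_Ioc_eq_integral_Ioo, setIntegral_congr_fun measurableSet_Ioo h1,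
    setIntegral_congr_fun measurableSet_Ioc h2, ← integral_Ioc_eq_integral_Ioo,
    integral_const_mul _ h, integral_const_mul _ h, ← intervalIntegral.integral_of_le hl,
    ← intervalIntegral.integral_of_le hr, hFTC, hFTC]
  have e1 : E (u / N) = Complex.exp (Complex.I * u) := by
    simp only [hE]
    rw [mul_div_cancel₀ _ hN.ne']
  have e2 : (Real.cos N : ℂ) = (E 1 + E (-1)) / 2 := by
    simp only [hE, Complex.ofReal_cos, Complex.cos]
    push_cast
    ring_nf
  rw [e1, e2]
  ring

/-- Barron's representation: a Barron function agrees on `B`, up to a constant, with a mixture of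
steps of total mass at most `2 c`. The frequency `ω` has density `‖ω‖_B |ĝ(ω)|` and the threshold is
uniformly distributed on `[-‖ω‖_B, ‖ω‖_B]`. -/
theorem IsBarronOn.exists_stepMixture {n : ℕ} {B : Set (EuclideanSpace ℝ (Fin n))}
    (hB : Bornology.IsBounded B) {c : ℝ} {φ : EuclideanSpace ℝ (Fin n) → ℝ}
    (hφ : IsBarronOn B c φ) :
    ∃ (S : StepMixture n (EuclideanSpace ℝ (Fin n) × ℝ) ℝ) (κ : ℝ),
      S.law.real Set.univ ≤ 2 * c ∧ ∀ y ∈ B, φ y = κ + S.eval y := by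
  obtain ⟨g, hgφ, ⟨hg, hrep⟩, hint, hle⟩ := hφ
  set A := fourierHat g with hA
  set N := setNorm B with hN
  have hAc : Continuous A := continuous_fourierHat hg
  have hNc : Continuous N := continuous_setNorm hB
  have hN0 : ∀ ω, 0 ≤ N ω := setNorm_nonneg B
  have hd0 : ∀ ω, 0 ≤ N ω * ‖A ω‖ := fun ω => mul_nonneg (hN0 ω) (norm_nonneg _)
  set d : EuclideanSpace ℝ (Fin n) → ENNReal := fun ω => ENNReal.ofReal (N ω * ‖A ω‖) with hd
  have hdm : Measurable d := (hNc.mul hAc.norm).measurable.ennreal_ofReal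
  set lam : Measure (EuclideanSpace ℝ (Fin n)) := volume.withDensity d with hlam
  have hlamu : lam Set.univ = ENNReal.ofReal (∫ ω, N ω * ‖A ω‖) := by
    rw [hlam, withDensity_apply _ MeasurableSet.univ, Measure.restrict_univ,
      ofReal_integral_eq_lintegral_ofReal hint (ae_of_all _ hd0)]
  have hfin : IsFiniteMeasure lam := ⟨by rw [hlamu]; exact ENNReal.ofReal_lt_top⟩
  have hlamint : ∀ h : EuclideanSpace ℝ (Fin n) → ℝ,
      ∫ ω, h ω ∂lam = ∫ ω, N ω * ‖A ω‖ * h ω := fun h => by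
    rw [hlam, integral_withDensity_eq_integral_toReal_smul hdm
      (ae_of_all _ fun ω => ENNReal.ofReal_lt_top)]
    simp only [hd, ENNReal.toReal_ofReal (hd0 _), smul_eq_mul]
  set ν : Measure ℝ := volume.restrict (Set.Icc (-1) 1) with hν
  -- the sign of the step; it is `0` (as `0 / 0`) where `A` vanishes
  let θ : EuclideanSpace ℝ (Fin n) × ℝ → ℝ := fun p =>
    (Complex.I * Complex.exp (Complex.I * (N p.1 * p.2 : ℝ)) * A p.1).re / ‖A p.1‖
  have hθm : Measurable θ := by
    refine Measurable.div ?_ (hAc.norm.measurable.comp measurable_fst)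
    exact Continuous.measurable (by fun_prop)
  have hθ1 : ∀ p, ‖θ p‖ ≤ 1 := fun p => by
    rw [Real.norm_eq_abs, abs_div, abs_norm]
    refine div_le_one_of_le₀ ((Complex.abs_re_le_norm _).trans_eq ?_) (norm_nonneg _)
    rw [norm_mul, norm_mul, mul_comm Complex.I (Complex.ofReal _), Complex.norm_exp_ofReal_mul_I]
    simp
  let S : StepMixture n (EuclideanSpace ℝ (Fin n) × ℝ) ℝ :=
    { law := lam.prod ν
      finite := inferInstance
      ω := Prod.fst
      t := fun p => N p.1 * p.2
      v := θ
      measurable_ω := measurable_fst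
      measurable_t := (hNc.measurable.comp measurable_fst).mul measurable_snd
      stronglyMeasurable_v := hθm.stronglyMeasurable
      norm_v_le := hθ1
      ae_ne := fun y => by
        have hms : MeasurableSet {p : EuclideanSpace ℝ (Fin n) × ℝ |
            inner ℝ p.1 y ≠ N p.1 * p.2} :=
          (isOpen_ne_fun (by fun_prop) (by fun_prop)).measurableSet
        rw [Measure.ae_prod_iff_ae_ae hms, hlam, ae_withDensity_iff hdm]
        refine ae_of_all _ fun ω hω => ?_
        have hNω : N ω ≠ 0 := fun h0 => hω (by simp [hd, h0])
        have : ∀ᵐ τ : ℝ ∂ν, τ ≠ inner ℝ ω y / N ω :=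
          ae_restrict_of_ae (Measure.ae_ne volume _)
        filter_upwards [this] with τ hτ h
        exact hτ (by rw [h, mul_div_cancel_left₀ _ hNω]) }
  -- the constant collects `g 0` and the terms `cos ‖ω‖_B - 1`, which do not depend on the point
  refine ⟨S, g 0 + (∫ ω, ((Real.cos (N ω) - 1 : ℝ) : ℂ) * A ω).re, ?_, fun y hy => ?_⟩
  · have : S.law Set.univ = ENNReal.ofReal (∫ ω, N ω * ‖A ω‖) * ENNReal.ofReal 2 := by
      change (lam.prod ν) Set.univ = _
      rw [← Set.univ_prod_univ, Measure.prod_prod, hlamu, hν, Measure.restrict_apply_univ,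
        Real.volume_Icc]
      norm_num
    rw [Measure.real, this, ENNReal.toReal_mul, ENNReal.toReal_ofReal (integral_nonneg hd0),
      ENNReal.toReal_ofReal two_pos.le]
    linarith
  · obtain ⟨hi, he⟩ := hrep y hy
    have hcos : Integrable fun ω => ((Real.cos (N ω) - 1 : ℝ) : ℂ) * A ω := by
      refine hint.mono' (Continuous.aestronglyMeasurable (by fun_prop)) (ae_of_all _ fun ω => ?_)
      rw [norm_mul, Complex.norm_real]
      refine mul_le_mul_of_nonneg_right ?_ (norm_nonneg _)
      rw [Real.norm_eq_abs, abs_le]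
      have h1 := Real.one_sub_sq_div_two_le_cos (x := N ω)
      constructor
      · rcases le_total (N ω) 2 with h2 | h2
        · nlinarith [hN0 ω]
        · linarith [Real.neg_one_le_cos (N ω)]
      · linarith [Real.cos_le_one (N ω), hN0 ω]
    have hinner : ∀ ω, N ω * ‖A ω‖ * ∫ τ, centredStep (inner ℝ ω y - N ω * τ) * θ (ω, τ) ∂ν =
        ((Complex.exp (Complex.I * (inner ℝ ω y : ℝ)) - 1) * A ω).re -
          (((Real.cos (N ω) - 1 : ℝ) : ℂ) * A ω).re := fun ω => by
      rw [← Complex.sub_re, ← sub_mul]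
      have h1 := integral_centredStep_mul_exp (abs_inner_le_setNorm hB hy ω)
      have h2 : Complex.exp (Complex.I * (inner ℝ ω y : ℝ)) - 1 - ((Real.cos (N ω) - 1 : ℝ) : ℂ) =
          Complex.exp (Complex.I * (inner ℝ ω y : ℝ)) - Real.cos (N ω) := by
        push_cast
        ring
      rw [h2, ← h1, ← integral_mul_const, ← integral_const_mul]
      have h3 : Integrable (fun τ : ℝ => (centredStep (inner ℝ ω y - N ω * τ) : ℂ) *
          (Complex.I * N ω * Complex.exp (Complex.I * (N ω * τ : ℝ))) * A ω) ν := by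
        refine Integrable.of_bound (Measurable.aestronglyMeasurable ?_)
          (1 / 2 * N ω * ‖A ω‖) (ae_of_all _ fun τ => ?_)
        · refine (Measurable.mul (Complex.measurable_ofReal.comp
            (measurable_centredStep.comp (by fun_prop))) ?_).mul_const _
          exact Continuous.measurable (by fun_prop)
        · rw [norm_mul, norm_mul, norm_mul, norm_mul, mul_comm Complex.I (Complex.ofReal _),
            Complex.norm_exp_ofReal_mul_I, Complex.norm_real, Complex.norm_real,
            Real.norm_eq_abs, abs_centredStep, Real.norm_eq_abs, abs_of_nonneg (hN0 ω)]
          simp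
      have h4 := integral_re h3
      simp only [RCLike.re_eq_complex_re] at h4
      refine Eq.trans (integral_congr_ae (ae_of_all _ fun τ => ?_)) h4
      rcases eq_or_ne (A ω) 0 with hA0 | hA0
      · simp [hA0]
      have hA0' : ‖A ω‖ ≠ 0 := norm_ne_zero_iff.2 hA0
      have h5 : (centredStep (inner ℝ ω y - N ω * τ) : ℂ) *
          (Complex.I * N ω * Complex.exp (Complex.I * (N ω * τ : ℝ))) * A ω =
          ((centredStep (inner ℝ ω y - N ω * τ) * N ω : ℝ) : ℂ) *
          (Complex.I * Complex.exp (Complex.I * (N ω * τ : ℝ)) * A ω) := by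
        push_cast
        ring
      simp only [h5, Complex.re_ofReal_mul, θ]
      field_simp
    have heval : S.eval y = ∫ ω, (((Complex.exp (Complex.I * (inner ℝ ω y : ℝ)) - 1) * A ω).re -
          (((Real.cos (N ω) - 1 : ℝ) : ℂ) * A ω).re) := by
      have hI : Integrable (fun p => centredStep (inner ℝ (S.ω p) y - S.t p) • S.v p)
          (lam.prod ν) :=
        Integrable.of_bound ((S.stronglyMeasurable_neuron
          measurable_centredStep).comp_measurable measurable_prodMk_right).aestronglyMeasurable
          (1 / 2) (ae_of_all _ fun p => S.norm_neuron_le (fun u => (abs_centredStep u).le) _ p)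
      refine (integral_prod _ hI).trans ?_
      rw [hlamint]
      exact integral_congr_ae (ae_of_all _ hinner)
    have hre1 := integral_re hi
    have hre2 := integral_re hcos
    simp only [RCLike.re_eq_complex_re] at hre1 hre2
    have hi' : Integrable fun ω =>
        ((Complex.exp (Complex.I * (inner ℝ ω y : ℝ)) - 1) * A ω).re := hi.re
    have hcos' : Integrable fun ω => (((Real.cos (N ω) - 1 : ℝ) : ℂ) * A ω).re := hcos.re
    have hg' := congrArg Complex.re he
    simp only [Complex.ofReal_re, Complex.add_re] at hg'
    rw [heval, integral_sub hi' hcos', hre1, hre2, ← hgφ y hy, hg']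
    ring

/-! ### Approximation of a single layer -/

/-- Scalar mixtures of steps, one for each coordinate, form a vector-valued mixture. -/
theorem StepMixture.exists_pi {n m : ℕ} {P : Type*} [MeasurableSpace P]
    (S : Fin m → StepMixture n P ℝ) :
    ∃ T : StepMixture n (Fin m × P) (EuclideanSpace ℝ (Fin m)),
      T.law.real Set.univ = ∑ j, (S j).law.real Set.univ ∧
      ∀ y, T.eval y = WithLp.toLp 2 fun j => (S j).eval y := by
  have hmk : ∀ j : Fin m, Measurable fun p : P => (j, p) := fun j => measurable_prodMk_left
  let law : Measure (Fin m × P) := ∑ j, (S j).law.map (Prod.mk j)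
  have hlawfin : IsFiniteMeasure law := by
    refine ⟨?_⟩
    simp only [law, Measure.coe_finsetSum, Finset.sum_apply]
    refine ENNReal.sum_lt_top.2 fun j _ => ?_
    rw [Measure.map_apply (hmk j) MeasurableSet.univ]
    exact measure_lt_top _ _
  have hvm : Measurable fun z : Fin m × P => EuclideanSpace.single z.1 ((S z.1).v z.2) := by
    refine measurable_from_prod_countable_right fun j => ?_
    have hlin : Continuous fun a : ℝ => (EuclideanSpace.single j a : EuclideanSpace ℝ (Fin m)) :=
      (PiLp.continuous_toLp 2 _).comp (continuous_single (A := fun _ : Fin m => ℝ) j)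
    exact hlin.measurable.comp (S j).stronglyMeasurable_v.measurable
  let T : StepMixture n (Fin m × P) (EuclideanSpace ℝ (Fin m)) :=
    { law := law
      finite := hlawfin
      ω := fun z => (S z.1).ω z.2
      t := fun z => (S z.1).t z.2
      v := fun z => EuclideanSpace.single z.1 ((S z.1).v z.2)
      measurable_ω := measurable_from_prod_countable_right fun j => (S j).measurable_ω
      measurable_t := measurable_from_prod_countable_right fun j => (S j).measurable_t
      stronglyMeasurable_v := hvm.stronglyMeasurable
      norm_v_le := fun z => by simpa using (S z.1).norm_v_le z.2
      ae_ne := fun y => by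
        have hms : MeasurableSet {z : Fin m × P | inner ℝ ((S z.1).ω z.2) y ≠ (S z.1).t z.2} := by
          refine (measurableSet_eq_fun ?_ ?_).compl
          · exact Measurable.inner
              (measurable_from_prod_countable_right fun j => (S j).measurable_ω) measurable_const
          · exact measurable_from_prod_countable_right fun j => (S j).measurable_t
        simp only [law, ← Measure.sum_fintype]
        rw [Measure.ae_sum_iff]
        intro j
        rw [ae_map_iff (hmk j).aemeasurable hms]
        exact (S j).ae_ne y }
  have hTint : ∀ y, ∀ j : Fin m, Integrable
      (fun p => centredStep (inner ℝ (T.ω p) y - T.t p) • T.v p) ((S j).law.map (Prod.mk j)) :=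
    fun y j => by
      have : IsFiniteMeasure ((S j).law.map (Prod.mk j)) := Measure.isFiniteMeasure_map _ _
      exact Integrable.of_bound ((T.stronglyMeasurable_neuron
        measurable_centredStep).comp_measurable measurable_prodMk_right).aestronglyMeasurable
        (1 / 2) (ae_of_all _ fun p => T.norm_neuron_le (fun u => (abs_centredStep u).le) _ p)
  refine ⟨T, ?_, fun y => ?_⟩
  · change law.real Set.univ = _
    simp only [Measure.real, law, Measure.coe_finsetSum, Finset.sum_apply]
    rw [ENNReal.toReal_sum fun j _ => by
      rw [Measure.map_apply (hmk j) MeasurableSet.univ]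
      exact measure_ne_top _ _]
    refine Finset.sum_congr rfl fun j _ => ?_
    rw [Measure.map_apply (hmk j) MeasurableSet.univ, Set.preimage_univ]
  · have hsingle : ∀ (j : Fin m) (a : ℝ), (EuclideanSpace.single j a : EuclideanSpace ℝ (Fin m)) =
        a • EuclideanSpace.single j 1 := fun j a => by
      ext i
      simp
    have h1 : T.eval y = ∑ j, EuclideanSpace.single j ((S j).eval y) := by
      change ∫ p, _ ∂law = _
      rw [integral_finsetSum_measure fun j _ => hTint y j]
      refine Finset.sum_congr rfl fun j _ => ?_
      rw [integral_map (hmk j).aemeasurable (hTint y j).aestronglyMeasurable]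
      rw [hsingle j ((S j).eval y), StepMixture.eval, ← integral_smul_const]
      refine integral_congr_ae (ae_of_all _ fun p => ?_)
      simp only [T]
      rw [hsingle j ((S j).v p), smul_smul, smul_eq_mul]
    rw [h1]
    ext i
    simp [Pi.single_apply]

/-- What a single layer has to provide: `f` extends from `B` to a measurable function on the whole
space whose values are at distance at most `R` from each other and which is approximated by shallow
networks with `r` nodes up to the mean square error `ρ`, for every probability measure. -/
def ShallowApproximable (σ : ℝ → ℝ) {n m : ℕ} (B : Set (EuclideanSpace ℝ (Fin n)))
    (f : EuclideanSpace ℝ (Fin n) → EuclideanSpace ℝ (Fin m)) (r : ℕ) (R ρ : ℝ) : Prop :=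
  ∃ F : EuclideanSpace ℝ (Fin n) → EuclideanSpace ℝ (Fin m), Measurable F ∧
    (∀ y ∈ B, F y = f y) ∧ (∀ y y', ‖F y - F y'‖ ≤ R) ∧
    ∀ μ : Measure (EuclideanSpace ℝ (Fin n)), IsProbabilityMeasure μ →
      ∃ g, IsShallow σ r g ∧ ∫ y, ‖F y - g y‖ ^ 2 ∂μ ≤ ρ

lemma IsShallow.const_add {σ : ℝ → ℝ} {n r : ℕ} {V : Type*} [AddCommGroup V] [Module ℝ V]
    {g : EuclideanSpace ℝ (Fin n) → V} (hg : IsShallow σ r g) (κ : V) :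
    IsShallow σ r fun y => κ + g y := by
  obtain ⟨a, b, w, κ', hg⟩ := hg
  exact ⟨a, b, w, κ + κ', fun y => by simp only [hg, add_assoc]⟩

lemma IsBarronOn.nonneg {n : ℕ} {B : Set (EuclideanSpace ℝ (Fin n))} {c : ℝ}
    {φ : EuclideanSpace ℝ (Fin n) → ℝ} (h : IsBarronOn B c φ) : 0 ≤ c := by
  obtain ⟨g, -, -, -, hle⟩ := h
  exact (integral_nonneg fun ω => mul_nonneg (setNorm_nonneg B ω) (norm_nonneg _)).trans hle

/-- The coordinates share the `r` nodes: the neurons are drawn from the joint mixture, whose mass is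
at most `2 ∑ⱼ cⱼ ≤ 2 C √m` by the Cauchy–Schwarz inequality. -/
theorem IsVectorBarronOn.shallowApproximable {σ : ℝ → ℝ} (hσ : IsSigmoidal σ) {n m : ℕ}
    {B : Set (EuclideanSpace ℝ (Fin n))} (hB : Bornology.IsBounded B) {C ε : ℝ} (hε : 0 < ε)
    {f : EuclideanSpace ℝ (Fin n) → EuclideanSpace ℝ (Fin m)} (hf : IsVectorBarronOn B C f) :
    ShallowApproximable σ B f ⌈4 * C ^ 2 * m / ε ^ 2⌉₊ (2 * C * √m) (ε ^ 2 / 2) := by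
  obtain ⟨c, hc, hcC⟩ := hf
  choose S κ hS hκ using fun j => (hc j).exists_stepMixture hB
  obtain ⟨T, hT, hTe⟩ := StepMixture.exists_pi S
  have hC : 0 ≤ C := (Real.sqrt_nonneg _).trans hcC
  have hmass : T.law.real Set.univ ≤ 2 * C * √m := by
    have h1 : ∑ j, c j ≤ √m * √(∑ j, c j ^ 2) := by
      have := Real.sum_mul_le_sqrt_mul_sqrt Finset.univ (fun _ : Fin m => (1 : ℝ)) c
      simpa using this
    have h2 : √m * √(∑ j, c j ^ 2) ≤ √m * C := mul_le_mul_of_nonneg_left hcC (Real.sqrt_nonneg _)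
    have h3 : T.law.real Set.univ ≤ 2 * ∑ j, c j := by
      rw [hT, Finset.mul_sum]
      exact Finset.sum_le_sum fun j _ => hS j
    linarith
  refine ⟨fun y => WithLp.toLp 2 κ + T.eval y,
    (T.stronglyMeasurable_eval.measurable.const_add _), fun y hy => ?_, fun y y' => ?_,
    fun μ hμ => ?_⟩
  · ext j
    simp [hTe, hκ j y hy]
  · rw [add_sub_add_left_eq_sub]
    exact (T.norm_eval_sub_eval_le y y').trans hmass
  · obtain ⟨g, hg, hgρ⟩ := T.exists_shallow hσ (ρ := ε ^ 2 / 2) (by positivity)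
      (r := ⌈4 * C ^ 2 * m / ε ^ 2⌉₊) (by
        have h1 : 4 * C ^ 2 * m ≤ ⌈4 * C ^ 2 * m / ε ^ 2⌉₊ * ε ^ 2 :=
          (div_le_iff₀ (by positivity)).1 (Nat.le_ceil _)
        have h2 := pow_le_pow_left₀ measureReal_nonneg hmass 2
        rw [mul_pow, Real.sq_sqrt m.cast_nonneg] at h2
        linarith) μ
    refine ⟨_, hg.const_add (WithLp.toLp 2 κ), ?_⟩
    simpa only [add_sub_add_left_eq_sub] using hgρ

/-- Every coordinate has a network of its own, with mean square error `ε² / (2 m)`. -/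
theorem IsComponentwiseBarronOn.shallowApproximable {σ : ℝ → ℝ} (hσ : IsSigmoidal σ) {n m : ℕ}
    {B : Set (EuclideanSpace ℝ (Fin n))} (hB : Bornology.IsBounded B) {C ε : ℝ} (hε : 0 < ε)
    {f : EuclideanSpace ℝ (Fin n) → EuclideanSpace ℝ (Fin m)}
    (hf : IsComponentwiseBarronOn B C f) :
    ShallowApproximable σ B f (m * ⌈4 * C ^ 2 * m / ε ^ 2⌉₊) (2 * C * √m) (ε ^ 2 / 2) := by
  choose S κ hS hκ using fun j => (hf j).exists_stepMixture hB
  have hbd : ∀ y y' : EuclideanSpace ℝ (Fin n),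
      ‖(WithLp.toLp 2 fun j => κ j + (S j).eval y : EuclideanSpace ℝ (Fin m)) -
        WithLp.toLp 2 fun j => κ j + (S j).eval y'‖ ≤ 2 * C * √m := fun y y' => by
    -- for `m = 0` the sign of `C` is unknown, but the factor `√m` vanishes
    rcases m.eq_zero_or_pos with rfl | hm
    · simp [Subsingleton.elim (_ : EuclideanSpace ℝ (Fin 0)) 0]
    have hC : 0 ≤ C := (hf ⟨0, hm⟩).nonneg
    rw [EuclideanSpace.norm_eq]
    refine Real.sqrt_le_iff.2 ⟨by positivity, ?_⟩
    calc _ ≤ ∑ _j : Fin m, (2 * C) ^ 2 := Finset.sum_le_sum fun j _ => by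
          refine pow_le_pow_left₀ (norm_nonneg _) ?_ 2
          simpa using ((S j).norm_eval_sub_eval_le y y').trans (hS j)
      _ = (2 * C * √m) ^ 2 := by
          rw [mul_pow _ (√m), Real.sq_sqrt m.cast_nonneg]
          simp [mul_comm]
  refine ⟨fun y => WithLp.toLp 2 fun j => κ j + (S j).eval y, ?_, fun y hy => ?_, hbd,
    fun μ hμ => ?_⟩
  · exact (PiLp.continuous_toLp 2 _).measurable.comp
      (measurable_pi_lambda _ fun j => (S j).stronglyMeasurable_eval.measurable.const_add _)
  · ext j
    simp [hκ j y hy]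
  · set r := ⌈4 * C ^ 2 * m / ε ^ 2⌉₊ with hr
    have hcomp : ∀ j : Fin m, ∃ g, IsShallow σ r g ∧
        ∫ y, ‖(S j).eval y - g y‖ ^ 2 ∂μ ≤ ε ^ 2 / 2 / m := fun j => by
      have hm : (0 : ℝ) < m := Nat.cast_pos.2 (j.pos)
      refine (S j).exists_shallow hσ (by positivity) ?_ μ
      have h1 : 4 * C ^ 2 * m ≤ r * ε ^ 2 := (div_le_iff₀ (by positivity)).1 (Nat.le_ceil _)
      have h2 := pow_le_pow_left₀ measureReal_nonneg (hS j) 2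
      have h3 : ε ^ 2 / 2 / m * r = r * ε ^ 2 / (2 * m) := by field_simp
      rw [h3, le_div_iff₀ (by positivity)]
      nlinarith
    choose g hg hgρ using hcomp
    have hint : ∀ j, Integrable (fun y => ‖(S j).eval y - g j y‖ ^ 2) μ := fun j => by
      obtain ⟨M, hM⟩ := (hg j).exists_norm_le hσ.bounded
      refine Integrable.of_bound (((S j).stronglyMeasurable_eval.measurable.sub
        ((hg j).measurable hσ.measurable)).norm.pow_const 2).aestronglyMeasurable
        (((S j).law.real Set.univ / 2 + M) ^ 2) (ae_of_all _ fun y => ?_)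
      rw [norm_pow, norm_norm]
      exact pow_le_pow_left₀ (norm_nonneg _)
        ((norm_sub_le _ _).trans (add_le_add ((S j).norm_eval_le y) (hM y))) 2
    refine ⟨_, IsShallow.pi fun j => (hg j).const_add (κ j), ?_⟩
    calc _ = ∫ y, ∑ j, ‖(S j).eval y - g j y‖ ^ 2 ∂μ := by
          refine integral_congr_ae (ae_of_all _ fun y => ?_)
          simp [EuclideanSpace.norm_sq_eq]
      _ = ∑ j, ∫ y, ‖(S j).eval y - g j y‖ ^ 2 ∂μ := integral_finsetSum _ fun j _ => hint j
      _ ≤ ∑ _j : Fin m, ε ^ 2 / 2 / m := Finset.sum_le_sum fun j _ => hgρ j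
      _ ≤ ε ^ 2 / 2 := by
          rcases m.eq_zero_or_pos with rfl | hm
          · simp; positivity
          · have : (m : ℝ) ≠ 0 := by positivity
            simp only [Finset.sum_const, Finset.card_univ, Fintype.card_fin, nsmul_eq_mul]
            rw [mul_div_cancel₀ _ this]

/-! ### Approximation of a composition -/

lemma ShallowApproximable.exists_shallow_comp {σ : ℝ → ℝ} (hσ : IsSigmoidal σ) {n m r : ℕ}
    {B : Set (EuclideanSpace ℝ (Fin n))}
    {f : EuclideanSpace ℝ (Fin n) → EuclideanSpace ℝ (Fin m)} {R ρ : ℝ}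
    (hf : ShallowApproximable σ B f r R ρ) {Ω : Type*} [MeasurableSpace Ω] (μ : Measure Ω)
    [IsProbabilityMeasure μ] {G : Ω → EuclideanSpace ℝ (Fin n)} (hG : Measurable G) :
    ∃ (F g : EuclideanSpace ℝ (Fin n) → EuclideanSpace ℝ (Fin m)),
      (∀ y ∈ B, F y = f y) ∧ (∀ y y', ‖F y - F y'‖ ≤ R) ∧ IsShallow σ r g ∧ Measurable g ∧
      Integrable (fun x => ‖F (G x) - g (G x)‖ ^ 2) μ ∧
      ∫ x, ‖F (G x) - g (G x)‖ ^ 2 ∂μ ≤ ρ := by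
  obtain ⟨F, hF, hFf, hFR, happ⟩ := hf
  obtain ⟨g, hg, hgρ⟩ := happ (μ.map G) (Measure.isProbabilityMeasure_map hG.aemeasurable)
  have hgm := hg.measurable hσ.measurable
  obtain ⟨M, hM⟩ := hg.exists_norm_le hσ.bounded
  have hm : Measurable fun y => ‖F y - g y‖ ^ 2 := (hF.sub hgm).norm.pow_const 2
  refine ⟨F, g, hFf, hFR, hg, hgm, ?_, ?_⟩
  · refine Integrable.of_bound (hm.comp hG).aestronglyMeasurable ((R + ‖F 0‖ + M) ^ 2)
      (ae_of_all _ fun x => ?_)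
    rw [norm_pow, norm_norm]
    refine pow_le_pow_left₀ (norm_nonneg _) ((norm_sub_le _ _).trans (add_le_add ?_ (hM _))) 2
    exact (norm_le_norm_sub_add _ (F 0)).trans (add_le_add_left (hFR _ _) _)
  · rwa [integral_map hG.aemeasurable hm.aestronglyMeasurable] at hgρ

lemma mem_add_closedBall {V : Type*} [SeminormedAddCommGroup V] {K : Set V} {x y : V} {s : ℝ}
    (hx : x ∈ K) (hxy : ‖x - y‖ ≤ s) : y ∈ K + Metric.closedBall 0 s :=
  ⟨x, hx, y - x, by rwa [mem_closedBall_zero_iff, norm_sub_rev], by simp⟩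

lemma composeUpTo_mem {m : ℕ → ℕ}
    {f : (i : ℕ) → EuclideanSpace ℝ (Fin (m i)) → EuclideanSpace ℝ (Fin (m (i + 1)))}
    {K : (i : ℕ) → Set (EuclideanSpace ℝ (Fin (m i)))} {l : ℕ}
    (hmaps : ∀ i < l, f i '' K i ⊆ K (i + 1)) {x : EuclideanSpace ℝ (Fin (m 0))} (hx : x ∈ K 0) :
    ∀ k ≤ l, composeUpTo f k x ∈ K k
  | 0, _ => hx
  | k + 1, hk => hmaps k hk ⟨_, composeUpTo_mem hmaps hx k (Nat.le_of_succ_le hk), rfl⟩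

lemma continuous_composeUpTo {m : ℕ → ℕ}
    {f : (i : ℕ) → EuclideanSpace ℝ (Fin (m i)) → EuclideanSpace ℝ (Fin (m (i + 1)))} :
    ∀ {l : ℕ}, (∀ i < l, Continuous (f i)) → Continuous (composeUpTo f l)
  | 0, _ => continuous_id
  | l + 1, hf => (hf l l.lt_succ_self).comp
      (continuous_composeUpTo fun i hi => hf i (hi.trans l.lt_succ_self))

lemma add_sq_le_succ_mul {k W U d : ℝ} (hk : 0 ≤ k) (hU : 0 ≤ U) (h : W ^ 2 ≤ k * U) :
    (W + d) ^ 2 ≤ (k + 1) * (U + d ^ 2) := by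
  have h1 : (2 * W * d) ^ 2 ≤ (U + k * d ^ 2) ^ 2 := by
    nlinarith [mul_le_mul_of_nonneg_right h (sq_nonneg d), sq_nonneg (U - k * d ^ 2)]
  have h2 := abs_le_of_sq_le_sq' h1 (by positivity)
  nlinarith [h2.2]

/-- As long as the accumulated one-layer errors `W` stay below the margin `s`, the network stays
within `W` of the target: since the maps are `1`-Lipschitz, the errors of the layers only add up.
The function `U` is the sum of the squares of the one-layer errors. -/
lemma exists_deep_of_margin {σ : ℝ → ℝ} (hσ : IsSigmoidal σ) {s ρ : ℝ} {m r : ℕ → ℕ}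
    {f : (i : ℕ) → EuclideanSpace ℝ (Fin (m i)) → EuclideanSpace ℝ (Fin (m (i + 1)))}
    {K : (i : ℕ) → Set (EuclideanSpace ℝ (Fin (m i)))} {R : ℕ → ℝ}
    (μ : Measure (EuclideanSpace ℝ (Fin (m 0)))) [IsProbabilityMeasure μ] (k : ℕ)
    (hLip : ∀ i < k, LipschitzWith 1 (f i)) (hmaps : ∀ i < k, f i '' K i ⊆ K (i + 1))
    (happ : ∀ i < k, ShallowApproximable σ (K i + Metric.closedBall 0 s) (f i) (r i) (R i) ρ) :
    ∃ G, IsDeep σ m r k G ∧ Measurable G ∧ ∃ W U : EuclideanSpace ℝ (Fin (m 0)) → ℝ,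
      (∀ x, 0 ≤ W x) ∧ (∀ x, 0 ≤ U x) ∧ (∀ x, W x ^ 2 ≤ k * U x) ∧ Integrable U μ ∧
      ∫ x, U x ∂μ ≤ k * ρ ∧ ∀ x ∈ K 0, W x ≤ s → ‖composeUpTo f k x - G x‖ ≤ W x := by
  induction k with
  | zero => exact ⟨id, rfl, measurable_id, 0, 0, by simp, by simp, by simp,
      integrable_zero _ _ _, by simp, by simp [composeUpTo]⟩
  | succ k ih =>
    obtain ⟨G, hG, hGm, W, U, hW, hU, hWU, hUi, hUρ, hGW⟩ :=
      ih (fun i hi => hLip i (hi.trans k.lt_succ_self))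
        (fun i hi => hmaps i (hi.trans k.lt_succ_self))
        (fun i hi => happ i (hi.trans k.lt_succ_self))
    obtain ⟨F, g, hFf, -, hg, hgm, hδi, hδρ⟩ :=
      (happ k k.lt_succ_self).exists_shallow_comp hσ μ hGm
    refine ⟨g ∘ G, ⟨G, g, hG, hg, rfl⟩, hgm.comp hGm, fun x => W x + ‖F (G x) - g (G x)‖,
      fun x => U x + ‖F (G x) - g (G x)‖ ^ 2, fun x => add_nonneg (hW x) (norm_nonneg _),
      fun x => add_nonneg (hU x) (sq_nonneg _), fun x => ?_, hUi.add hδi, ?_, fun x hx hxs => ?_⟩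
    · push_cast
      exact add_sq_le_succ_mul k.cast_nonneg (hU x) (hWU x)
    · rw [integral_add hUi hδi]
      push_cast
      linarith
    · have hδ0 := norm_nonneg (F (G x) - g (G x))
      have hWs : W x ≤ s := by linarith
      have he := hGW x hx hWs
      have hGB : G x ∈ K k + Metric.closedBall 0 s := mem_add_closedBall
        (composeUpTo_mem (fun i hi => hmaps i (hi.trans k.lt_succ_self)) hx k le_rfl)
        (he.trans hWs)
      have h1 : ‖f k (composeUpTo f k x) - f k (G x)‖ ≤ ‖composeUpTo f k x - G x‖ := by
        simpa using (hLip k k.lt_succ_self).norm_sub_le (composeUpTo f k x) (G x)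
      calc ‖composeUpTo f (k + 1) x - (g ∘ G) x‖
          = ‖(f k (composeUpTo f k x) - f k (G x)) + (F (G x) - g (G x))‖ := by
            rw [hFf _ hGB, sub_add_sub_cancel]
            rfl
        _ ≤ W x + ‖F (G x) - g (G x)‖ :=
            (norm_add_le _ _).trans (add_le_add_left (h1.trans he) _)

/-- The approximation of a composition. Where the errors of the first `l - 1` layers exceed the
margin `s`, the last target may be wrong by `R`, which is at most `R` times the accumulated error
divided by `s`; elsewhere it is wrong by no more than the accumulated error. -/
theorem exists_network_L2Within {σ : ℝ → ℝ} (hσ : IsSigmoidal σ) {ε s : ℝ} (hε : 0 < ε)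
    (hs : 0 < s) {l : ℕ} (hl : 1 ≤ l) {m r : ℕ → ℕ}
    {f : (i : ℕ) → EuclideanSpace ℝ (Fin (m i)) → EuclideanSpace ℝ (Fin (m (i + 1)))}
    {K : (i : ℕ) → Set (EuclideanSpace ℝ (Fin (m i)))} {C : ℕ → ℝ}
    {μ : Measure (EuclideanSpace ℝ (Fin (m 0)))} [IsProbabilityMeasure μ]
    (hsupp : μ.support ⊆ K 0) (hLip : ∀ i < l, LipschitzWith 1 (f i))
    (hmaps : ∀ i < l, f i '' K i ⊆ K (i + 1))
    (happ : ∀ i < l, ShallowApproximable σ (K i + Metric.closedBall 0 s) (f i) (r i)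
      (2 * C (i + 1) * √(m (i + 1))) (ε ^ 2 / 2)) :
    ∃ g : NeuralNetwork (m l) (m 0) (List.ofFn fun i : Fin l => r i),
      L2Within μ (K 0) (composeUpTo f l) (g.eval σ)
        (l * ε * √((2 * C l * √(m l) + Metric.diam (K l)) ^ 2 * (l / (3 * s ^ 2)) + 1)) := by
  obtain ⟨k, rfl⟩ : ∃ k, l = k + 1 := ⟨l - 1, by omega⟩
  obtain ⟨G, hG, hGm, W, U, hW, hU, hWU, hUi, hUρ, hGW⟩ :=
    exists_deep_of_margin hσ μ k (fun i hi => hLip i (hi.trans k.lt_succ_self))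
      (fun i hi => hmaps i (hi.trans k.lt_succ_self))
      (fun i hi => happ i (hi.trans k.lt_succ_self))
  obtain ⟨F, g, hFf, hFR, hg, hgm, hδi, hδρ⟩ :=
    (happ k k.lt_succ_self).exists_shallow_comp hσ μ hGm
  obtain ⟨N, hN⟩ := IsDeep.exists_network (k := k + 1) (G := g ∘ G) ⟨G, g, hG, hg, rfl⟩
  refine ⟨N, ?_⟩
  rw [hN]
  set R := 2 * C (k + 1) * √(m (k + 1)) with hR
  have hR0 : 0 ≤ R := (norm_nonneg _).trans (hFR 0 0)
  have hK0 : ∀ᵐ x ∂μ, x ∈ K 0 := by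
    filter_upwards [Measure.support_mem_ae (μ := μ)] with x hx using hsupp hx
  have hpt : ∀ x ∈ K 0, ‖composeUpTo f (k + 1) x - (g ∘ G) x‖ ^ 2 ≤
      2 * (1 + R ^ 2 / s ^ 2) * (k * U x) + 2 * ‖F (G x) - g (G x)‖ ^ 2 := fun x hx => by
    have hhK := composeUpTo_mem (fun i hi => hmaps i (Nat.lt_succ_of_lt hi)) hx k le_rfl
    have hkey : ‖f k (composeUpTo f k x) - F (G x)‖ ^ 2 ≤ (1 + R ^ 2 / s ^ 2) * W x ^ 2 := by
      rcases le_or_gt (W x) s with hWs | hWs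
      · have he := hGW x hx hWs
        have hGB : G x ∈ K k + Metric.closedBall 0 s := mem_add_closedBall hhK (he.trans hWs)
        have h1 : ‖f k (composeUpTo f k x) - F (G x)‖ ≤ W x := by
          rw [hFf _ hGB]
          refine le_trans ?_ he
          simpa using (hLip k k.lt_succ_self).norm_sub_le (composeUpTo f k x) (G x)
        refine (pow_le_pow_left₀ (norm_nonneg _) h1 2).trans ?_
        exact le_mul_of_one_le_left (sq_nonneg _) (le_add_of_nonneg_right (by positivity))
      · rw [← hFf _ (mem_add_closedBall hhK (by simpa using hs.le))]
        have h1 : R ≤ R / s * W x := by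
          rw [div_mul_eq_mul_div, le_div_iff₀ hs]
          exact mul_le_mul_of_nonneg_left hWs.le hR0
        refine (pow_le_pow_left₀ (norm_nonneg _) ((hFR _ _).trans h1) 2).trans ?_
        rw [mul_pow, div_pow, add_mul]
        exact le_add_of_nonneg_left (by positivity)
    have hsplit : composeUpTo f (k + 1) x - (g ∘ G) x =
        (f k (composeUpTo f k x) - F (G x)) + (F (G x) - g (G x)) := by
      rw [sub_add_sub_cancel]
      rfl
    have h2 : (1 + R ^ 2 / s ^ 2) * W x ^ 2 ≤ (1 + R ^ 2 / s ^ 2) * (k * U x) :=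
      mul_le_mul_of_nonneg_left (hWU x) (by positivity)
    have h3 := pow_le_pow_left₀ (norm_nonneg _) (norm_add_le
      (f k (composeUpTo f k x) - F (G x)) (F (G x) - g (G x))) 2
    rw [hsplit]
    nlinarith [sq_nonneg (‖f k (composeUpTo f k x) - F (G x)‖ - ‖F (G x) - g (G x)‖)]
  have hbound : Integrable (fun x => 2 * (1 + R ^ 2 / s ^ 2) * (k * U x) +
      2 * ‖F (G x) - g (G x)‖ ^ 2) μ := ((hUi.const_mul _).const_mul _).add (hδi.const_mul _)
  have hint : Integrable (fun x => ‖composeUpTo f (k + 1) x - (g ∘ G) x‖ ^ 2) μ := by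
    refine hbound.mono' (Measurable.aestronglyMeasurable ?_) ?_
    · exact ((continuous_composeUpTo fun i hi => (hLip i hi).continuous).measurable.sub
        (hgm.comp hGm)).norm.pow_const 2
    · filter_upwards [hK0] with x hx
      rw [norm_pow, norm_norm]
      exact hpt x hx
  refine ⟨hint.integrableOn, ?_⟩
  rw [Measure.restrict_eq_self_of_ae_mem hK0]
  refine Real.sqrt_le_iff.2 ⟨by positivity, ?_⟩
  have hle : ∫ x, ‖composeUpTo f (k + 1) x - (g ∘ G) x‖ ^ 2 ∂μ ≤
      2 * (1 + R ^ 2 / s ^ 2) * (k * (k * (ε ^ 2 / 2))) + 2 * (ε ^ 2 / 2) := by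
    refine (integral_mono_ae hint hbound (hK0.mono hpt)).trans ?_
    rw [integral_add ((hUi.const_mul _).const_mul _) (hδi.const_mul _), integral_const_mul,
      integral_const_mul, integral_const_mul]
    gcongr
  refine hle.trans ?_
  set D := Metric.diam (K (k + 1)) with hD
  have hD0 : 0 ≤ D := Metric.diam_nonneg
  have hk : (0 : ℝ) ≤ k := k.cast_nonneg
  have hRD : R ^ 2 ≤ (R + D) ^ 2 := pow_le_pow_left₀ hR0 (le_add_of_nonneg_right hD0) 2
  -- the square of the claimed bound dominates `ε² ((1 + R² / s²) k² + 1)`, with `l = k + 1`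
  have hcube : 3 * (k : ℝ) ^ 2 ≤ (k + 1) ^ 3 := by nlinarith [pow_nonneg hk 3]
  have hmain : R ^ 2 * (3 * (k : ℝ) ^ 2) ≤ (R + D) ^ 2 * (k + 1) ^ 3 :=
    mul_le_mul hRD hcube (by positivity) (by positivity)
  have hdiv : R ^ 2 / s ^ 2 * (k : ℝ) ^ 2 ≤
      (k + 1) ^ 2 * ((R + D) ^ 2 * ((k + 1) / (3 * s ^ 2))) := by
    rw [show R ^ 2 / s ^ 2 * (k : ℝ) ^ 2 = R ^ 2 * (3 * (k : ℝ) ^ 2) / (3 * s ^ 2) by field_simp,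
      show ((k : ℝ) + 1) ^ 2 * ((R + D) ^ 2 * ((k + 1) / (3 * s ^ 2))) =
        (R + D) ^ 2 * (k + 1) ^ 3 / (3 * s ^ 2) by field_simp]
    exact div_le_div_of_nonneg_right hmain (by positivity)
  have hsum : (1 + R ^ 2 / s ^ 2) * (k : ℝ) ^ 2 + 1 ≤
      (k + 1) ^ 2 * ((R + D) ^ 2 * ((k + 1) / (3 * s ^ 2)) + 1) := by nlinarith
  push_cast
  rw [mul_pow (((k : ℝ) + 1) * ε), Real.sq_sqrt (by positivity), mul_pow ((k : ℝ) + 1) ε]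
  linarith [mul_le_mul_of_nonneg_left hsum (sq_nonneg ε)]

theorem theorem3p1 (σ : ℝ → ℝ) (hσ : IsSigmoidal σ) (ε s : ℝ) (hε : 0 < ε) (hs : 0 < s)
    (l : ℕ) (hl : 1 ≤ l) (m : ℕ → ℕ)
    (f : (i : ℕ) → EuclideanSpace ℝ (Fin (m i)) → EuclideanSpace ℝ (Fin (m (i + 1))))
    (K : (i : ℕ) → Set (EuclideanSpace ℝ (Fin (m i)))) (C : ℕ → ℝ)
    (μ₀ : MeasureTheory.Measure (EuclideanSpace ℝ (Fin (m 0))))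
    [MeasureTheory.IsProbabilityMeasure μ₀]
    (hK : ∀ i ≤ l, Bornology.IsBounded (K i))
    (hsupp : μ₀.support ⊆ K 0)
    (hLip : ∀ i < l, LipschitzWith 1 (f i))
    (hmaps : ∀ i < l, f i '' K i ⊆ K (i + 1)) :
    ((∀ i < l, IsVectorBarronOn (K i + Metric.closedBall 0 s) (C (i + 1)) (f i)) →
      ∃ g : NeuralNetwork (m l) (m 0)
          (List.ofFn fun i : Fin l => ⌈4 * C ((i : ℕ) + 1) ^ 2 * m ((i : ℕ) + 1) / ε ^ 2⌉₊),
        L2Within μ₀ (K 0) (composeUpTo f l) (g.eval σ)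
          (l * ε * √((2 * C l * √(m l) + Metric.diam (K l)) ^ 2 * (l / (3 * s ^ 2)) + 1))) ∧
    ((∀ i < l, IsComponentwiseBarronOn (K i + Metric.closedBall 0 s) (C (i + 1)) (f i)) →
      ∃ g : NeuralNetwork (m l) (m 0)
          (List.ofFn fun i : Fin l => m ((i : ℕ) + 1) * ⌈4 * C ((i : ℕ) + 1) ^ 2 * m ((i : ℕ) + 1) / ε ^ 2⌉₊),
        L2Within μ₀ (K 0) (composeUpTo f l) (g.eval σ)
          (l * ε * √((2 * C l * √(m l) + Metric.diam (K l)) ^ 2 * (l / (3 * s ^ 2)) + 1))) := by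
  have hB : ∀ i < l, Bornology.IsBounded (K i + Metric.closedBall 0 s) := fun i hi =>
    (hK i hi.le).add Metric.isBounded_closedBall
  exact ⟨fun h => exists_network_L2Within hσ hε hs hl
      (r := fun i => ⌈4 * C (i + 1) ^ 2 * m (i + 1) / ε ^ 2⌉₊) hsupp hLip hmaps
      fun i hi => (h i hi).shallowApproximable hσ (hB i hi) hε,
    fun h => exists_network_L2Within hσ hε hs hl
      (r := fun i => m (i + 1) * ⌈4 * C (i + 1) ^ 2 * m (i + 1) / ε ^ 2⌉₊) hsupp hLip hmaps
      fun i hi => (h i hi).shallowApproximable hσ (hB i hi) hε⟩
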